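/- **Setting.** Let $M$ be a smooth, complete Riemannian manifold (with finite distance function $d$, i.e. connected), with Riemannian volume $\mu$, and let $V\to M$ be a smooth complex vector bundle of rank $N$ with a smooth Hermitian metric $h$ and a smooth connection $\nabla$. All pointwise norms are those induced by the metrics on $M$ and $V$, and $B(x,r)$ denotes the open ball. $H^1(V)$ is the domain of the closure (again denoted $\nabla$) of $\nabla: u\mapsto\nabla u$ acting from the sections $u\in C^\infty\cap L^2(V)$ with $\nabla u\in L^2$ into $L^2(T^*M\otimes V)$; $H^1(M)$ is the case of the trivial bundle $M\times\mathbb C$ with $\nabla=d$. **Hypotheses.** 1. (Exponential local doubling) There are $c\ge 1$, $\kappa,\lambda\ge 0$ with $0<\mu(B(x,sr))\le c\,s^{\kappa}e^{\lambda sr}\mu(B(x,r))<\infty$ for all $x\in M$, $s\ge1$, $r>0$. 2. (Local Poincaré inequality) There is $c_P\ge1$ such that $\|f-f_B\|_{L^2(B)}\le c_P\,\mathrm{rad}(B)\,\|f\|_{H^1(B)}$ for all $f\in H^1(M)$ and all balls $B$ with $\mathrm{rad}(B)\le1$, where $f_B=\mu(B)^{-1}\int_B f\,d\mu$. 3. (Generalised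 bounded geometry, GBG) There are $0<\rho\le5$ and $C_0\ge1$ and, for each $x\in M$, a smooth local trivialisation $\psi_x$ of $V$ over $B(x,\rho)$, called a GBG chart, with frame $e^i(y)=\psi_x(y,\tilde e^i)$, $\tilde e^1,\dots,\tilde e^N$ being the standard basis of $\mathbb C^N$, such that $C_0^{-1}|w|^2\le|\psi_x(y,w)|^2_{h}\le C_0|w|^2$ for all $y\in B(x,\rho)$ and $w\in\mathbb C^N$. 4. (Bounded gradients) There is $C_G>0$ such that $|\nabla e^i|\le C_G$ on $B(x,\rho)$ for every $x\in M$, every $i$, and the frame $\{e^i\}$ of $\psi_x$. **Dyadic cubes.** Fix a truncated dyadic structure on $M$: countable index sets $I_k$ ($k=0,1,2,\dots$), open sets $Q^k_\alpha\subset M$ ($\alpha\in I_k$) with centres $z^k_\alpha\in Q^k_\alpha$, and constants $\delta\in(0,1)$, $a_0,\eta,C_1,C_2>0$ such that - $\mu(M\setminus\bigcup_\alpha Q^k_\alpha)=0$ for each $k$; - if $l\ge k$, then $Q^l_\beta\subset Q^k_\alpha$ or $Q^l_\beta\cap Q^k_\alpha=\emptyset$; - for each $(k,\alpha)$ and $l<k$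 there is a unique $\beta$ with $Q^k_\alpha\subset Q^l_\beta$; - $\operatorname{diam}Q^k_\alpha\le C_1\delta^k$ and $B(z^k_\alpha,a_0\delta^k)\subset Q^k_\alpha$; - $\mu\{x\in Q^k_\alpha: d(x,M\setminus Q^k_\alpha)\le s\delta^k\}\le C_2s^\eta\mu(Q^k_\alpha)$ for all $s>0$ (with $d(x,\emptyset)=\infty$). Fix $J$ with $C_1\delta^J\le\rho/5$. For $0<t\le\delta^J$ let $\mathcal D_t=\{Q^k_\alpha:\alpha\in I_k\}$, where $\delta^{k+1}<t\le\delta^k$. For $Q\in\mathcal D_t$ with centre $x_Q$, let $\widehat Q=Q^J_\beta$ be the cube of generation $J$ containing $Q$, with centre $x_{\widehat Q}$. For $u\in H^1(V)$, writing $u=u_ie^i$ in the GBG chart $\psi_{x_{\widehat Q}}$, let $u_Q=\big(\mu(Q)^{-1}\int_Q u_i\,d\mu\big)e^i$ on $B(x_{\widehat Q},\rho)$ and $u_Q=0$ elsewhere. **Claim.** There is a constant $C>0$, independent of $u,t,Q,r$, such that for all $u\in H^1(V)$, all $0<t\le\delta^J$, all $Q\in\mathcal D_t$ and all $r\ge C_1/\delta$,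 with $B=B(x_Q,rt)$, $$\int_B|u-u_Q|^2\,d\mu\le C\,(1+r^{\kappa}e^{\lambda rt})\,(rt)^2\int_B\big(|\nabla u|^2+|u|^2\big)\,d\mu .$$ -/

import Mathlib

open Bundle Manifold MeasureTheory Filter Topology
open scoped ContDiff ENNReal

noncomputable section

/-! ## The base manifold -/

/-- The coordinate tangent vector `∂_i` of the chart at `x₀`, at the point of `M` with
coordinates `y`. -/
def coordVec (n : ℕ) {M : Type*} [TopologicalSpace M] [ChartedSpace (EuclideanSpace ℝ (Fin n)) M]
    (x₀ : M) (y : EuclideanSpace ℝ (Fin n)) (i : Fin n) :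
    TangentSpace (𝓡 n) ((extChartAt (𝓡 n) x₀).symm y) :=
  mfderiv 𝓘(ℝ, EuclideanSpace ℝ (Fin n)) (𝓡 n) (extChartAt (𝓡 n) x₀).symm y
    (EuclideanSpace.single i (1 : ℝ))

/-- The matrix `g_ij = g(∂_i, ∂_j)` of the Riemannian metric in the chart at `x₀`, at the point
with coordinates `y`. -/
def metricMatrix (n : ℕ) {M : Type*} [TopologicalSpace M]
    [ChartedSpace (EuclideanSpace ℝ (Fin n)) M]
    [RiemannianBundle (fun x : M => TangentSpace (𝓡 n) x)]
    (x₀ : M) (y : EuclideanSpace ℝ (Fin n)) : Matrix (Fin n) (Fin n) ℝ :=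
  Matrix.of fun i j => inner ℝ (coordVec n x₀ y i) (coordVec n x₀ y j)

/-- The Riemannian volume `√(det g_ij) dy` of the domain of the chart at `x₀`, extended by zero
to a measure on `M`. -/
def chartVolume (n : ℕ) {M : Type*} [TopologicalSpace M]
    [ChartedSpace (EuclideanSpace ℝ (Fin n)) M] [MeasurableSpace M]
    [RiemannianBundle (fun x : M => TangentSpace (𝓡 n) x)] (x₀ : M) : Measure M :=
  Measure.map (extChartAt (𝓡 n) x₀).symm
    ((volume.restrict (extChartAt (𝓡 n) x₀).target).withDensity
      fun y => ENNReal.ofReal √(metricMatrix n x₀ y).det)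

/-- The Riemannian volume measure. The volumes of the chart domains are the restrictions of one
measure to open sets of which countably many cover `M`; that measure is their supremum. -/
def riemannianVolume (n : ℕ) (M : Type*) [TopologicalSpace M]
    [ChartedSpace (EuclideanSpace ℝ (Fin n)) M] [MeasurableSpace M]
    [RiemannianBundle (fun x : M => TangentSpace (𝓡 n) x)] : Measure M :=
  ⨆ x₀ : M, chartVolume n x₀

/-- Exponentially locally doubling volume growth, with constants `c`, `κ`, `lam`. -/
structure ExpLocallyDoubling {M : Type*} [PseudoMetricSpace M] [MeasurableSpace M]
    (μ : Measure M) (c κ lam : ℝ) : Prop where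
  one_le_c : 1 ≤ c
  κ_nonneg : 0 ≤ κ
  lam_nonneg : 0 ≤ lam
  pos : ∀ (x : M) (r : ℝ), 0 < r → 0 < μ (Metric.ball x r)
  lt_top : ∀ (x : M) (r : ℝ), 0 < r → μ (Metric.ball x r) < ⊤
  growth : ∀ (x : M) (t r : ℝ), 1 ≤ t → 0 < r →
    μ (Metric.ball x (t * r)) ≤
      ENNReal.ofReal (c * t ^ κ * Real.exp (lam * t * r)) * μ (Metric.ball x r)

/-! ## Sections, gradients and `H¹` -/

/-- Measurability of a section (up to a null set), with the Borel sets of the total space. -/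
def AEMeasurableSection {M : Type*} [MeasurableSpace M] (F : Type*) {V : M → Type*}
    [TopologicalSpace (TotalSpace F V)] (μ : Measure M) (u : ∀ x, V x) : Prop :=
  @AEMeasurable M (TotalSpace F V) (borel _) _ (fun x => TotalSpace.mk' F x (u x)) μ

instance tangentSpace_finiteDimensional (n : ℕ) {M : Type*} [TopologicalSpace M]
    [ChartedSpace (EuclideanSpace ℝ (Fin n)) M] (x : M) :
    FiniteDimensional ℝ (TangentSpace (𝓡 n) x) :=
  inferInstanceAs (FiniteDimensional ℝ (EuclideanSpace ℝ (Fin n)))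

/-- The squared norm of `A ∈ T*_x M ⊗ V_x` for the metric induced by `g` and by the squared norm
`q` on `V_x`: the sum of `q (A E_i)` over a `g`-orthonormal basis `E_i` of `T_x M`. -/
def gradNormSq {n : ℕ} {M : Type*} [TopologicalSpace M]
    [ChartedSpace (EuclideanSpace ℝ (Fin n)) M]
    [RiemannianBundle (fun x : M => TangentSpace (𝓡 n) x)] {x : M} {W : Type*}
    [AddCommGroup W] [Module ℝ W] [TopologicalSpace W] (q : W → ℝ)
    (A : TangentSpace (𝓡 n) x →L[ℝ] W) : ℝ :=
  ∑ i, q (A (stdOrthonormalBasis ℝ (TangentSpace (𝓡 n) x) i))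

/-- `u ∈ H¹(V)` with `∇u = du`: the pair `(u, du)` lies in the closure, in
`L²(V) × L²(T*M ⊗ V)`, of the graph of the operator `D` on the smooth `L²` sections `s` for which
`D s` is in `L²`. Here `q` is the squared norm on the fibres. -/
structure IsSobolevGradient {n : ℕ} {M : Type*} [TopologicalSpace M]
    [ChartedSpace (EuclideanSpace ℝ (Fin n)) M] [IsManifold (𝓡 n) 1 M] [MeasurableSpace M]
    [RiemannianBundle (fun x : M => TangentSpace (𝓡 n) x)] (μ : Measure M)
    (F : Type*) [NormedAddCommGroup F] [NormedSpace ℝ F] {V : M → Type*}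
    [TopologicalSpace (TotalSpace F V)] [∀ x, AddCommGroup (V x)] [∀ x, Module ℝ (V x)]
    [∀ x, TopologicalSpace (V x)] [∀ x, IsTopologicalAddGroup (V x)]
    [∀ x, ContinuousSMul ℝ (V x)] [FiberBundle F V] [VectorBundle ℝ F V]
    (q : ∀ x, V x → ℝ) (D : (∀ x, V x) → ∀ x, TangentSpace (𝓡 n) x →L[ℝ] V x)
    (u : ∀ x, V x) (du : ∀ x, TangentSpace (𝓡 n) x →L[ℝ] V x) : Prop where
  measurable : AEMeasurableSection F μ u
  measurable_grad : AEMeasurableSection (EuclideanSpace ℝ (Fin n) →L[ℝ] F)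
    (V := fun x => TangentSpace (𝓡 n) x →L[ℝ] V x) μ du
  approx : ∃ s : ℕ → ∀ x, V x,
    (∀ k, ContMDiff (𝓡 n) ((𝓡 n).prod 𝓘(ℝ, F)) ∞ (fun x => TotalSpace.mk' F x (s k x))) ∧
    (∀ k, ∫⁻ x, ENNReal.ofReal (q x (s k x)) ∂μ < ⊤) ∧
    (∀ k, ∫⁻ x, ENNReal.ofReal (gradNormSq (q x) (D (s k) x)) ∂μ < ⊤) ∧
    Tendsto (fun k => ∫⁻ x, ENNReal.ofReal (q x (s k x - u x)) ∂μ) atTop (𝓝 0) ∧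
    Tendsto (fun k => ∫⁻ x, ENNReal.ofReal (gradNormSq (q x) (D (s k) x - du x)) ∂μ)
      atTop (𝓝 0)

/-- `f ∈ H¹(M)` with gradient `df`: the case of the trivial bundle `M × ℂ`, the flat connection
and the standard norm. -/
def IsSobolevGradientFun {n : ℕ} {M : Type*} [TopologicalSpace M]
    [ChartedSpace (EuclideanSpace ℝ (Fin n)) M] [IsManifold (𝓡 n) 1 M] [MeasurableSpace M]
    [RiemannianBundle (fun x : M => TangentSpace (𝓡 n) x)] (μ : Measure M)
    (f : M → ℂ) (df : ∀ x : M, TangentSpace (𝓡 n) x →L[ℝ] ℂ) : Prop :=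
  IsSobolevGradient μ ℂ (V := Trivial M ℂ) (fun _ z => Complex.normSq z)
    (fun f x => mfderiv (𝓡 n) 𝓘(ℝ, ℂ) f x) f df

/-- The local Poincaré inequality `‖f - f_B‖_{L²(B)} ≤ c rad(B) ‖f‖_{H¹(B)}` for all
`f ∈ H¹(M)` and all balls `B` with `rad(B) ≤ 1`, in squared form. -/
def LocalPoincare (n : ℕ) {M : Type*} [MetricSpace M]
    [ChartedSpace (EuclideanSpace ℝ (Fin n)) M] [IsManifold (𝓡 n) 1 M] [MeasurableSpace M]
    [RiemannianBundle (fun x : M => TangentSpace (𝓡 n) x)] (μ : Measure M) : Prop :=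
  ∃ c : ℝ, 1 ≤ c ∧ ∀ (f : M → ℂ) (df : ∀ x : M, TangentSpace (𝓡 n) x →L[ℝ] ℂ),
    IsSobolevGradientFun μ f df → ∀ (x : M) (R : ℝ), 0 < R → R ≤ 1 →
      ∫⁻ y in Metric.ball x R,
          ENNReal.ofReal (Complex.normSq (f y - ⨍ z in Metric.ball x R, f z ∂μ)) ∂μ ≤
        ENNReal.ofReal ((c * R) ^ 2) * ∫⁻ y in Metric.ball x R,
          ENNReal.ofReal (Complex.normSq (f y) + gradNormSq Complex.normSq (df y)) ∂μ

/-! ## Hermitian metrics and generalised bounded geometry -/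

/-- A smooth Hermitian metric on a complex vector bundle over a real manifold, conjugate linear
in the first variable. -/
structure HermitianMetric (n : ℕ) {M : Type*} [TopologicalSpace M]
    [ChartedSpace (EuclideanSpace ℝ (Fin n)) M] (F : Type*) [NormedAddCommGroup F]
    [NormedSpace ℝ F] (V : M → Type*) [TopologicalSpace (TotalSpace F V)]
    [∀ x, AddCommGroup (V x)] [∀ x, Module ℂ (V x)] [∀ x, TopologicalSpace (V x)]
    [FiberBundle F V] where
  form : ∀ x, V x →ₗ⋆[ℂ] V x →ₗ[ℂ] ℂ
  conj_symm : ∀ x (v w : V x), (starRingEnd ℂ) (form x v w) = form x w v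
  pos : ∀ x (v : V x), v ≠ 0 → 0 < (form x v v).re
  smooth : ∀ (U : Set M), IsOpen U → ∀ σ τ : ∀ x, V x,
    ContMDiffOn (𝓡 n) ((𝓡 n).prod 𝓘(ℝ, F)) ∞ (fun x => TotalSpace.mk' F x (σ x)) U →
    ContMDiffOn (𝓡 n) ((𝓡 n).prod 𝓘(ℝ, F)) ∞ (fun x => TotalSpace.mk' F x (τ x)) U →
    ContMDiffOn (𝓡 n) 𝓘(ℝ, ℂ) ∞ (fun x => form x (σ x) (τ x)) U

/-- The squared norm `|v|² = h(v, v)`. -/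
def HermitianMetric.normSq {n : ℕ} {M : Type*} [TopologicalSpace M]
    [ChartedSpace (EuclideanSpace ℝ (Fin n)) M] {F : Type*} [NormedAddCommGroup F]
    [NormedSpace ℝ F] {V : M → Type*} [TopologicalSpace (TotalSpace F V)]
    [∀ x, AddCommGroup (V x)] [∀ x, Module ℂ (V x)] [∀ x, TopologicalSpace (V x)]
    [FiberBundle F V] (h : HermitianMetric n F V) (x : M) (v : V x) : ℝ :=
  (h.form x v v).re

/-- Generalised bounded geometry of a rank `N` bundle: its radius and constant, and the GBG charts
`ψ_x : B(x, radius) × ℂ^N → V`, given by their fibre isomorphisms `triv x y`. The values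
`triv x y` with `y ∉ B(x, radius)` carry no information and are never used. -/
structure GBG {n N : ℕ} {M : Type*} [MetricSpace M]
    [ChartedSpace (EuclideanSpace ℝ (Fin n)) M] {V : M → Type*}
    [TopologicalSpace (TotalSpace (EuclideanSpace ℂ (Fin N)) V)]
    [∀ x, AddCommGroup (V x)] [∀ x, Module ℂ (V x)] [∀ x, TopologicalSpace (V x)]
    [FiberBundle (EuclideanSpace ℂ (Fin N)) V]
    (h : HermitianMetric n (EuclideanSpace ℂ (Fin N)) V) where
  radius : ℝ
  radius_pos : 0 < radius
  radius_le : radius ≤ 5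
  const : ℝ
  one_le_const : 1 ≤ const
  triv : ∀ _x y : M, EuclideanSpace ℂ (Fin N) ≃ₗ[ℂ] V y
  smooth : ∀ (x : M) (i : Fin N),
    ContMDiffOn (𝓡 n) ((𝓡 n).prod 𝓘(ℝ, EuclideanSpace ℂ (Fin N))) ∞
      (fun y => TotalSpace.mk' (EuclideanSpace ℂ (Fin N)) y
        (triv x y (EuclideanSpace.single i (1 : ℂ))))
      (Metric.ball x radius)
  lower : ∀ x, ∀ y ∈ Metric.ball x radius, ∀ w : EuclideanSpace ℂ (Fin N),
    const⁻¹ * ‖w‖ ^ 2 ≤ h.normSq y (triv x y w)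
  upper : ∀ x, ∀ y ∈ Metric.ball x radius, ∀ w : EuclideanSpace ℂ (Fin N),
    h.normSq y (triv x y w) ≤ const * ‖w‖ ^ 2

namespace GBG

variable {n N : ℕ} {M : Type*} [MetricSpace M]
  [ChartedSpace (EuclideanSpace ℝ (Fin n)) M] {V : M → Type*}
  [TopologicalSpace (TotalSpace (EuclideanSpace ℂ (Fin N)) V)]
  [∀ x, AddCommGroup (V x)] [∀ x, Module ℂ (V x)] [∀ x, TopologicalSpace (V x)]
  [FiberBundle (EuclideanSpace ℂ (Fin N)) V]
  {h : HermitianMetric n (EuclideanSpace ℂ (Fin N)) V}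

/-- The frame `e^i` of the GBG chart `ψ_x`. -/
def frame (G : GBG h) (x : M) (i : Fin N) (y : M) : V y :=
  G.triv x y (EuclideanSpace.single i (1 : ℂ))

/-- The component `u_i` of `u = u_i e^i` in the GBG chart `ψ_x`. -/
def coord (G : GBG h) (x : M) (u : ∀ y, V y) (i : Fin N) (y : M) : ℂ :=
  (G.triv x y).symm (u y) i

open Classical in
/-- The average over `Q` of `u` in the GBG chart `ψ_x`: the section `(⨍_Q u_i dμ) e^i` on
`B(x, radius)`, and zero outside this ball. -/
def cubeAverage [MeasurableSpace M] (G : GBG h) (μ : Measure M) (x : M) (Q : Set M)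
    (u : ∀ y, V y) (y : M) : V y :=
  if y ∈ Metric.ball x G.radius then ∑ i, (⨍ z in Q, G.coord x u i z ∂μ) • G.frame x i y else 0

end GBG

/-! ## Dyadic cubes -/

/-- A truncated dyadic structure. -/
structure DyadicStructure {M : Type*} [MetricSpace M] [MeasurableSpace M] (μ : Measure M) where
  ι : ℕ → Type
  countable : ∀ k, Countable (ι k)
  cube : ∀ k, ι k → Set M
  centre : ∀ k, ι k → M
  δ : ℝ
  a₀ : ℝ
  η : ℝ
  C₁ : ℝ
  C₂ : ℝ
  δ_pos : 0 < δ
  δ_lt_one : δ < 1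
  a₀_pos : 0 < a₀
  η_pos : 0 < η
  C₁_pos : 0 < C₁
  C₂_pos : 0 < C₂
  isOpen : ∀ k α, IsOpen (cube k α)
  centre_mem : ∀ k α, centre k α ∈ cube k α
  cover : ∀ k, μ (⋃ α, cube k α)ᶜ = 0
  nested : ∀ k l, k ≤ l → ∀ (α : ι k) (β : ι l),
    cube l β ⊆ cube k α ∨ cube l β ∩ cube k α = ∅
  ancestor : ∀ k l, l < k → ∀ α : ι k, ∃! β : ι l, cube k α ⊆ cube l β
  diam_le : ∀ k α, Metric.ediam (cube k α) ≤ ENNReal.ofReal (C₁ * δ ^ k)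
  ball_subset : ∀ k α, Metric.ball (centre k α) (a₀ * δ ^ k) ⊆ cube k α
  boundary : ∀ k α (t : ℝ), 0 < t →
    μ {x ∈ cube k α | Metric.infEDist x (cube k α)ᶜ ≤ ENNReal.ofReal (t * δ ^ k)} ≤
      ENNReal.ofReal (C₂ * t ^ η) * μ (cube k α)

/-- Every cube of generation `k ≥ J` has a GBG cube, a cube of generation `J` containing it. -/
theorem DyadicStructure.exists_gbgCube {M : Type*} [MetricSpace M] [MeasurableSpace M]
    {μ : Measure M} (D : DyadicStructure μ) {J k : ℕ} (hJ : J ≤ k) (α : D.ι k) :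
    ∃ β : D.ι J, D.cube k α ⊆ D.cube J β := by
  rcases hJ.eq_or_lt with rfl | hlt
  · exact ⟨α, subset_rfl⟩
  · exact (D.ancestor k J hlt α).exists

end

/-! Put R = rt and compare R with ρ/5, where ρ is the GBG radius.

If R ≤ ρ/5, the ball B = B(x_Q, R) lies well inside the GBG chart of the cube of generation J. There
|u - u_Q|² ≤ C₀ ∑ |u_i - (u_i)_Q|², so it is enough to apply the scalar Poincaré inequality to each
coordinate. Two corrections are needed. The averages are over Q and not over B: by Cauchy–Schwarz on
Q the change costs a factor of order 1 + μ(B)/μ(Q) (`lintegral_normSq_sub_average_le`). As Q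
contains a ball of radius a₀δ^k with t ≤ δ^k, doubling bounds this quotient by a multiple of 1 + r^κ
e^{λrt} (`ExpLocallyDoubling.measure_ball_le`). The gradient is that of u_i and not of u: the
Leibniz rule gives ∑ du_i ⊗ e^i = ∇u - ∑ u_i ∇e^i, and since |∇e^i| ≤ C_G, |du_i|² is bounded by a
multiple of |∇u|² + |u|² (`GBG.gradNormSq_coord_le`).

If R > ρ/5, no gradient is needed: the same use of Cauchy–Schwarz bounds ∫_B |u_Q|² by a multiple of
μ(B)/μ(Q) ∫_Q |u|² (`GBG.lintegral_normSq_sub_cubeAverage_le`), and 1 ≤ 25 R²/ρ² supplies the factor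
R².

The Poincaré inequality is assumed for elements of H¹(M), whereas u_i is meaningful only on the
chart ball. It is therefore applied to the coordinates of smooth approximants of u, cut off to
compact support (`poincare_of_contMDiffOn`), and the estimate passes to the limit in L²
(`GBG.lintegral_normSq_coord_sub_average_le`). The cut-off needs compact closed balls, which follow
from doubling and completeness. The remaining work is regularity: norms are continuous on the total
spaces, and coordinates inherit smoothness and measurability through the Gram matrix of the frame
(`GBG.coord_eq`). -/

/-! ### Averages over a subset of comparable measure -/

section Averages

variable {X : Type*} [MeasurableSpace X] {μ : Measure X}

theorem ofReal_normSq_eq_enorm_sq (z : ℂ) : ENNReal.ofReal (Complex.normSq z) = ‖z‖ₑ ^ 2 := by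
  rw [Complex.normSq_eq_norm_sq, ENNReal.ofReal_pow (norm_nonneg _), ofReal_norm]

theorem normSq_add_le (z w : ℂ) :
    Complex.normSq (z + w) ≤ 2 * (Complex.normSq z + Complex.normSq w) := by
  simp only [Complex.normSq_apply, Complex.add_re, Complex.add_im]
  nlinarith [sq_nonneg (z.re - w.re), sq_nonneg (z.im - w.im)]

theorem ofReal_normSq_add_le (z w : ℂ) :
    ENNReal.ofReal (Complex.normSq (z + w)) ≤
      2 * (ENNReal.ofReal (Complex.normSq z) + ENNReal.ofReal (Complex.normSq w)) := by
  rw [← ENNReal.ofReal_add (Complex.normSq_nonneg _) (Complex.normSq_nonneg _),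
    show (2 : ℝ≥0∞) = ENNReal.ofReal 2 by simp, ← ENNReal.ofReal_mul zero_le_two]
  exact ENNReal.ofReal_le_ofReal (normSq_add_le z w)

/-- The Cauchy–Schwarz inequality for averages. -/
theorem ofReal_normSq_average_sub_le {Q : Set X} (h0 : μ Q ≠ 0) (ht : μ Q ≠ ⊤) {f : X → ℂ}
    (hf : AEMeasurable f (μ.restrict Q)) (m : ℂ) :
    μ Q * ENNReal.ofReal (Complex.normSq ((⨍ x in Q, f x ∂μ) - m)) ≤
      ∫⁻ x in Q, ENNReal.ofReal (Complex.normSq (f x - m)) ∂μ := by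
  have : IsFiniteMeasure (μ.restrict Q) := ⟨by simpa using ht.lt_top⟩
  have hg : AEStronglyMeasurable (fun x => f x - m) (μ.restrict Q) :=
    (hf.sub_const m).aestronglyMeasurable
  simp only [ofReal_normSq_eq_enorm_sq]
  -- Outside this trivial case `f` is integrable on `Q`, so its average is genuine and not the
  -- default value 0.
  by_cases hfin : ∫⁻ x in Q, ‖f x - m‖ₑ ^ 2 ∂μ = ⊤
  · rw [hfin]; exact le_top
  have hsq : ∫⁻ x in Q, ‖f x - m‖ₑ ∂μ ≤
      (∫⁻ x in Q, ‖f x - m‖ₑ ^ 2 ∂μ) ^ (1 / 2 : ℝ) * μ Q ^ (1 / 2 : ℝ) := by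
    have := ENNReal.lintegral_mul_le_Lp_mul_Lq (μ.restrict Q) (p := 2) (q := 2)
      (by constructor <;> norm_num) hg.enorm (aemeasurable_const (b := (1 : ℝ≥0∞)))
    simpa using this
  have hgi : Integrable (fun x => f x - m) (μ.restrict Q) := by
    refine ⟨hg, hsq.trans_lt (ENNReal.mul_lt_top ?_ ?_)⟩
    · exact ENNReal.rpow_lt_top_of_nonneg (by norm_num) hfin
    · exact ENNReal.rpow_lt_top_of_nonneg (by norm_num) ht
  have hfi : Integrable f (μ.restrict Q) := by
    simpa [Pi.add_def] using hgi.add (integrable_const m)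
  have hpos : 0 < μ.real Q := ENNReal.toReal_pos h0 ht
  have havg : μ.real Q • ((⨍ x in Q, f x ∂μ) - m) = ∫ x in Q, (f x - m) ∂μ := by
    rw [integral_sub hfi (integrable_const m), smul_sub, setAverage_eq,
      smul_inv_smul₀ hpos.ne']
    simp
  have h1 : μ Q * ‖(⨍ x in Q, f x ∂μ) - m‖ₑ ≤ ∫⁻ x in Q, ‖f x - m‖ₑ ∂μ := by
    have := enorm_integral_le_lintegral_enorm (μ := μ.restrict Q) (fun x => f x - m)
    rw [← havg, enorm_smul, Real.enorm_of_nonneg hpos.le, ofReal_measureReal ht] at this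
    exact this
  have h2 : (μ Q * ‖(⨍ x in Q, f x ∂μ) - m‖ₑ) ^ 2 ≤
      (∫⁻ x in Q, ‖f x - m‖ₑ ^ 2 ∂μ) * μ Q := by
    refine (pow_le_pow_left' (h1.trans hsq) 2).trans_eq ?_
    rw [mul_pow, ← ENNReal.rpow_natCast, ← ENNReal.rpow_mul, ← ENNReal.rpow_natCast,
      ← ENNReal.rpow_mul]
    norm_num
  rw [mul_pow, sq (μ Q), mul_assoc, mul_comm (∫⁻ x in Q, _ ∂μ)] at h2
  exact (ENNReal.mul_le_mul_iff_right h0 ht).1 h2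

/-- Replacing the best constant by the average over a subset of comparable measure. -/
theorem lintegral_normSq_sub_average_le {Q B : Set X} (hQB : Q ⊆ B) (h0 : μ Q ≠ 0)
    (ht : μ Q ≠ ⊤) {K : ℝ≥0∞} (hK : μ B ≤ K * μ Q) {f : X → ℂ}
    (hf : AEMeasurable f (μ.restrict Q)) (m : ℂ) :
    ∫⁻ x in B, ENNReal.ofReal (Complex.normSq (f x - ⨍ z in Q, f z ∂μ)) ∂μ ≤
      2 * (1 + K) * ∫⁻ x in B, ENNReal.ofReal (Complex.normSq (f x - m)) ∂μ := by
  set a := ⨍ z in Q, f z ∂μ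
  calc ∫⁻ x in B, ENNReal.ofReal (Complex.normSq (f x - a)) ∂μ
      ≤ ∫⁻ x in B, 2 * (ENNReal.ofReal (Complex.normSq (f x - m)) +
          ENNReal.ofReal (Complex.normSq (a - m))) ∂μ := by
        refine lintegral_mono fun x => ?_
        rw [show f x - a = (f x - m) + -(a - m) by ring, ← Complex.normSq_neg (a - m)]
        exact ofReal_normSq_add_le _ _
    _ = 2 * (∫⁻ x in B, ENNReal.ofReal (Complex.normSq (f x - m)) ∂μ +
          ENNReal.ofReal (Complex.normSq (a - m)) * μ B) := by
        rw [lintegral_const_mul' _ _ (by simp), lintegral_add_right _ measurable_const]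
        simp
    _ ≤ 2 * (∫⁻ x in B, ENNReal.ofReal (Complex.normSq (f x - m)) ∂μ +
          K * ∫⁻ x in B, ENNReal.ofReal (Complex.normSq (f x - m)) ∂μ) := by
        -- The constant |a - m|² is first integrated over `B`; `hK` moves it to `Q`, where
        -- Cauchy–Schwarz applies.
        refine mul_le_mul_right (add_le_add_right ?_ _) 2
        calc ENNReal.ofReal (Complex.normSq (a - m)) * μ B
            ≤ ENNReal.ofReal (Complex.normSq (a - m)) * (K * μ Q) := by gcongr
          _ = K * (μ Q * ENNReal.ofReal (Complex.normSq (a - m))) := by ring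
          _ ≤ _ := by
            gcongr
            exact (ofReal_normSq_average_sub_le h0 ht hf m).trans (lintegral_mono_set hQB)
    _ = _ := by ring

end Averages

/-! ### Doubling: compactness of balls and comparison of measures -/

section Doubling

variable {X : Type*} [MetricSpace X] [MeasurableSpace X]
  {μ : Measure X} {c κ lam : ℝ}

/-- Balls of an exponentially locally doubling measure are totally bounded. -/
theorem ExpLocallyDoubling.totallyBounded_ball [OpensMeasurableSpace X]
    (hμ : ExpLocallyDoubling μ c κ lam) (x : X)
    (R : ℝ) : TotallyBounded (Metric.ball x R) := by
  rcases le_or_gt R 0 with hR | hR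
  · rw [Metric.ball_eq_empty.2 hR]; exact totallyBounded_empty
  rw [Metric.totallyBounded_iff]
  intro ε hε
  by_contra! hcon
  have hsep : ∀ s : Finset X, (∀ y ∈ s, y ∈ Metric.ball x R) →
      ∃ y ∈ Metric.ball x R, ∀ z ∈ s, ε ≤ dist z y := by
    intro s _
    obtain ⟨y, hy, hy'⟩ := Set.not_subset.1 (hcon s s.finite_toSet)
    refine ⟨y, hy, fun z hz => ?_⟩
    by_contra! hlt
    exact hy' (Set.mem_biUnion (Finset.mem_coe.2 hz) (by rwa [Metric.mem_ball']))
  obtain ⟨f, hf, hdist⟩ := exists_seq_of_forall_finset_exists (· ∈ Metric.ball x R)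
    (fun z y => ε ≤ dist z y) hsep
  have hdisj : Pairwise (Function.onFun Disjoint fun i => Metric.ball (f i) (ε / 2)) := by
    intro i j hij
    refine Metric.ball_disjoint_ball ?_
    rcases hij.lt_or_gt with h | h
    · linarith [hdist i j h]
    · linarith [hdist j i h, dist_comm (f i) (f j)]
  -- With this dilation the ball of radius T·ε/2 = 2R + ε/2 about any `f i` contains B(x, R). So the
  -- disjoint balls B(f i, ε/2) have measures bounded below, yet they all lie in B(x, R + ε), of
  -- finite measure.
  set T : ℝ := 1 + 4 * R / ε
  have hT : 1 ≤ T := le_add_of_nonneg_right (by positivity)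
  have hT' : T * (ε / 2) = ε / 2 + 2 * R := by simp only [T]; field_simp; ring
  have hlow : ∀ i, μ (Metric.ball x R) ≤
      ENNReal.ofReal (c * T ^ κ * Real.exp (lam * T * (ε / 2))) *
        μ (Metric.ball (f i) (ε / 2)) := by
    intro i
    refine (measure_mono (Metric.ball_subset_ball' ?_)).trans
      (hμ.growth (f i) T (ε / 2) hT (by positivity))
    have := Metric.mem_ball'.1 (hf i)
    rw [hT']; linarith
  have hfin : ∑' i, μ (Metric.ball (f i) (ε / 2)) < ⊤ := by
    refine (tsum_meas_le_meas_iUnion_of_disjoint μ (fun _ => Metric.isOpen_ball.measurableSet)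
      hdisj).trans_lt ((measure_mono (Set.iUnion_subset fun i => ?_)).trans_lt
        (hμ.lt_top x (R + ε) (by positivity)))
    refine Metric.ball_subset_ball' ?_
    have := Metric.mem_ball.1 (hf i)
    linarith
  have htop : ∑' _ : ℕ, μ (Metric.ball x R) = ⊤ :=
    ENNReal.tsum_const_eq_top_of_ne_zero (hμ.pos x R hR).ne'
  have := ENNReal.tsum_le_tsum hlow
  rw [htop, ENNReal.tsum_mul_left] at this
  exact absurd this (not_le.2 (ENNReal.mul_lt_top ENNReal.ofReal_lt_top hfin))

/-- Total boundedness and completeness take the place of the Hopf–Rinow theorem. -/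
theorem ExpLocallyDoubling.isCompact_closedBall [OpensMeasurableSpace X] [CompleteSpace X]
    (hμ : ExpLocallyDoubling μ c κ lam) (x : X) (R : ℝ) : IsCompact (Metric.closedBall x R) := by
  refine TotallyBounded.isCompact_of_isClosed ?_ Metric.isClosed_closedBall
  exact (hμ.totallyBounded_ball x (R + 1)).subset (Metric.closedBall_subset_ball (by linarith))

/-- The measure of a ball of radius `r t` compared with a ball of radius `a s`, for `t ≤ s`. -/
theorem ExpLocallyDoubling.measure_ball_le (hμ : ExpLocallyDoubling μ c κ lam) (x : X)
    {a s r t : ℝ} (ha : 0 < a) (ht : 0 < t) (hts : t ≤ s) (hr : 0 < r) :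
    μ (Metric.ball x (r * t)) ≤
      ENNReal.ofReal (max 1 (c * (a ^ κ)⁻¹) * (1 + r ^ κ * Real.exp (lam * (r * t)))) *
        μ (Metric.ball x (a * s)) := by
  have hs : 0 < s := ht.trans_le hts
  have hE : 0 ≤ r ^ κ * Real.exp (lam * (r * t)) := by positivity
  -- If rt ≤ as, monotonicity suffices, and the summand 1 in the constant pays for this case.
  -- Otherwise doubling applies with the dilation rt/(as), which is at most r/a because t ≤ s.
  rcases le_total (r * t) (a * s) with h | h
  · refine (measure_mono (Metric.ball_subset_ball h)).trans ?_
    refine le_mul_of_one_le_left' ?_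
    rw [ENNReal.one_le_ofReal]
    nlinarith [le_max_left 1 (c * (a ^ κ)⁻¹)]
  · have h1 : 1 ≤ r * t / (a * s) := by rwa [one_le_div (by positivity)]
    have := hμ.growth x (r * t / (a * s)) (a * s) h1 (by positivity)
    rw [div_mul_cancel₀ _ (by positivity), mul_assoc lam,
      div_mul_cancel₀ _ (by positivity)] at this
    refine this.trans (mul_le_mul_left (ENNReal.ofReal_le_ofReal ?_) _)
    have h2 : (r * t / (a * s)) ^ κ ≤ (a ^ κ)⁻¹ * r ^ κ := by
      rw [inv_mul_eq_div, ← Real.div_rpow hr.le ha.le]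
      refine Real.rpow_le_rpow (by positivity) ?_ hμ.κ_nonneg
      rw [div_le_div_iff₀ (by positivity) ha]
      have := mul_le_mul_of_nonneg_left hts (mul_pos hr ha).le
      linarith
    have hc : 0 < c := by linarith [hμ.one_le_c]
    calc c * (r * t / (a * s)) ^ κ * Real.exp (lam * (r * t))
        ≤ c * ((a ^ κ)⁻¹ * r ^ κ) * Real.exp (lam * (r * t)) := by gcongr
      _ = c * (a ^ κ)⁻¹ * (r ^ κ * Real.exp (lam * (r * t))) := by ring
      _ ≤ max 1 (c * (a ^ κ)⁻¹) * (1 + r ^ κ * Real.exp (lam * (r * t))) := by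
        gcongr
        · exact le_max_right _ _
        · linarith

end Doubling

/-! ### Traces through Gram matrices -/

section GramMatrix

open Matrix

variable {ι κ E : Type*} [Fintype ι] [DecidableEq ι] [Fintype κ] [NormedAddCommGroup E]
  [InnerProductSpace ℝ E]

/-- Parseval's identity in the orthonormal basis `e`. -/
theorem gram_eq_toMatrix_mul {ι E : Type*} [Fintype ι] [NormedAddCommGroup E]
    [InnerProductSpace ℝ E] (b : Module.Basis ι ℝ E) (e : OrthonormalBasis ι ℝ E) :
    (Matrix.of fun i j => inner ℝ (b i) (b j)) =
      (e.toBasis.toMatrix b)ᵀ * e.toBasis.toMatrix b := by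
  ext i j
  simp only [Matrix.of_apply, Matrix.mul_apply, Matrix.transpose_apply, Module.Basis.toMatrix_apply,
    OrthonormalBasis.coe_toBasis_repr_apply, OrthonormalBasis.repr_apply_apply]
  rw [← e.sum_inner_mul_inner]
  simp [real_inner_comm]

theorem gram_det_ne_zero (b : Module.Basis ι ℝ E) (e : OrthonormalBasis ι ℝ E) :
    (Matrix.of fun i j => inner ℝ (b i) (b j)).det ≠ 0 := by
  let := e.toBasis.invertibleToMatrix b
  have := (Matrix.isUnit_iff_isUnit_det _).1 (isUnit_of_invertible (e.toBasis.toMatrix b))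
  rw [gram_eq_toMatrix_mul b e, Matrix.det_mul, Matrix.det_transpose]
  exact mul_ne_zero this.ne_zero this.ne_zero

/-- The trace of a bilinear form with respect to an inner product, in an arbitrary basis. -/
theorem sum_orthonormalBasis_eq_sum_gram_inv (b : Module.Basis ι ℝ E)
    (e : OrthonormalBasis κ ℝ E) (B : E →ₗ[ℝ] E →ₗ[ℝ] ℝ) :
    ∑ k, B (e k) (e k) =
      ∑ i, ∑ j, (Matrix.of fun i j => inner ℝ (b i) (b j))⁻¹ i j * B (b i) (b j) := by
  -- Reindexing makes the change of basis matrix `S` square.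
  set e' : OrthonormalBasis ι ℝ E := e.reindex (e.toBasis.indexEquiv b)
  have h1 : ∑ k, B (e k) (e k) = ∑ i, B (e' i) (e' i) := by
    rw [← (e.toBasis.indexEquiv b).symm.sum_comp]
    simp [e']
  set S := e'.toBasis.toMatrix b
  set β : Matrix ι ι ℝ := Matrix.of fun i j => B (e' i) (e' j)
  let : Invertible S := e'.toBasis.invertibleToMatrix b
  have hS : IsUnit S.det := (Matrix.isUnit_iff_isUnit_det _).1 (isUnit_of_invertible S)
  have hb : ∀ j, b j = ∑ i, S i j • e' i := by
    intro j
    have := e'.toBasis.sum_toMatrix_smul_self b j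
    simpa using this.symm
  have hβ : ∀ i j, B (b i) (b j) = (Sᵀ * β * S) i j := by
    intro i j
    rw [hb i, hb j]
    simp only [map_sum, map_smul, LinearMap.sum_apply, LinearMap.smul_apply, smul_eq_mul,
      Matrix.mul_apply, Matrix.transpose_apply, β, Matrix.of_apply, Finset.sum_mul,
      Finset.mul_sum]
    refine Finset.sum_congr rfl fun _ _ => Finset.sum_congr rfl fun _ _ => by ring
  have hG : (Matrix.of fun i j => inner ℝ (b i) (b j))⁻¹ = S⁻¹ * Sᵀ⁻¹ := by
    rw [gram_eq_toMatrix_mul b e', Matrix.mul_inv_rev]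
  have hsymm : (S⁻¹ * Sᵀ⁻¹)ᵀ = S⁻¹ * Sᵀ⁻¹ := by
    rw [Matrix.transpose_mul, Matrix.transpose_nonsing_inv, Matrix.transpose_nonsing_inv,
      Matrix.transpose_transpose]
  have h2 : ∑ i, ∑ j, (S⁻¹ * Sᵀ⁻¹) i j * (Sᵀ * β * S) i j =
      Matrix.trace ((S⁻¹ * Sᵀ⁻¹)ᵀ * (Sᵀ * β * S)) := by
    simp only [Matrix.trace, Matrix.diag_apply, Matrix.mul_apply (M := (S⁻¹ * Sᵀ⁻¹)ᵀ),
      Matrix.transpose_apply]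
    rw [Finset.sum_comm]
  have hSt : IsUnit Sᵀ.det := by rwa [Matrix.det_transpose]
  rw [h1, hG]
  simp only [hβ]
  -- Cyclicity of the trace: tr(S⁻¹ S⁻ᵀ Sᵀ β S) = tr β.
  rw [h2, hsymm, ← Matrix.mul_assoc, Matrix.trace_mul_comm]
  have : S * (S⁻¹ * Sᵀ⁻¹ * (Sᵀ * β)) = β := by
    rw [← Matrix.mul_assoc, ← Matrix.mul_assoc S, Matrix.mul_nonsing_inv S hS, Matrix.one_mul,
      ← Matrix.mul_assoc, Matrix.nonsing_inv_mul _ hSt, Matrix.one_mul]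
  rw [this]
  rfl

/-- Cramer's rule: adjugate and determinant are polynomials in the entries. -/
theorem ContinuousAt.matrix_nonsing_inv_apply {X 𝕜 : Type*} [TopologicalSpace X]
    [NontriviallyNormedField 𝕜] {A : X → Matrix ι ι 𝕜} {x : X}
    (hA : ∀ i j, ContinuousAt (fun y => A y i j) x)
    (hx : (A x).det ≠ 0) (i j : ι) : ContinuousAt (fun y => (A y)⁻¹ i j) x := by
  have hA' : ContinuousAt A x := continuousAt_pi.2 fun i => continuousAt_pi.2 fun j => hA i j
  have hdet : ContinuousAt (fun y => (A y).det) x :=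
    (Continuous.matrix_det continuous_id).continuousAt.comp hA'
  have hadj : ContinuousAt (fun y => (A y).adjugate i j) x :=
    ((Continuous.matrix_elem (Continuous.matrix_adjugate continuous_id) i j)).continuousAt.comp hA'
  simp only [Matrix.inv_def, Matrix.smul_apply, smul_eq_mul, Ring.inverse_eq_inv']
  exact (hdet.inv₀ hx).mul hadj

end GramMatrix

/-! ### Continuity of the norm of T*M ⊗ V -/

section TotalSpace

variable {n : ℕ} {M : Type*} [TopologicalSpace M] [ChartedSpace (EuclideanSpace ℝ (Fin n)) M]
  [IsManifold (𝓡 n) ∞ M] [RiemannianBundle (fun x : M => TangentSpace (𝓡 n) x)]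
  [IsContMDiffRiemannianBundle (𝓡 n) ∞ (EuclideanSpace ℝ (Fin n))
      (fun x : M => TangentSpace (𝓡 n) x)]

theorem Bundle.Trivialization.continuousOn_mk_symm {B F : Type*} {E : B → Type*}
    [TopologicalSpace B] [TopologicalSpace F] [TopologicalSpace (TotalSpace F E)]
    [∀ x, Zero (E x)] (e : Trivialization F (π F E)) (w : F) :
    ContinuousOn (fun y => TotalSpace.mk' F y (e.symm y w)) e.baseSet := by
  exact ContinuousOn.comp (g := fun z : B × F => TotalSpace.mk' F z.1 (e.symm z.1 z.2))
    (f := fun y => (y, w)) e.continuousOn_symm (Continuous.prodMk_left w).continuousOn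
    fun y hy => ⟨hy, Set.mem_univ w⟩

/-- The squared norm of `T*M ⊗ V` is a continuous function on the total space. -/
theorem continuous_gradNormSq {F : Type*} [NormedAddCommGroup F] [NormedSpace ℝ F]
    {V : M → Type*} [TopologicalSpace (TotalSpace F V)] [∀ x, AddCommGroup (V x)]
    [∀ x, Module ℝ (V x)] [∀ x, TopologicalSpace (V x)] [∀ x, IsTopologicalAddGroup (V x)]
    [∀ x, ContinuousSMul ℝ (V x)] [FiberBundle F V] [VectorBundle ℝ F V]
    (q : ∀ x, V x → ℝ) (B : ∀ x, V x →ₗ[ℝ] V x →ₗ[ℝ] ℝ) (hB : ∀ x v w, B x v w = B x w v)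
    (hq : ∀ x v, q x v = B x v v) (hc : Continuous fun p : TotalSpace F V => q p.1 p.2) :
    Continuous fun p : TotalSpace (EuclideanSpace ℝ (Fin n) →L[ℝ] F)
      (fun x => TangentSpace (𝓡 n) x →L[ℝ] V x) => gradNormSq (q p.1) p.2 := by
  have : IsContinuousRiemannianBundle (EuclideanSpace ℝ (Fin n))
      (fun x : M => TangentSpace (𝓡 n) x) := by
    obtain ⟨g, hg, hg'⟩ := IsContMDiffRiemannianBundle.exists_contMDiff (IB := 𝓡 n) (n := ∞)
      (F := EuclideanSpace ℝ (Fin n)) (E := fun x : M => TangentSpace (𝓡 n) x)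
    exact ⟨g, hg.continuous, hg'⟩
  rw [continuous_iff_continuousAt]
  intro p₀
  set e := trivializationAt (EuclideanSpace ℝ (Fin n)) (fun x : M => TangentSpace (𝓡 n) x) p₀.1
  have hp₀ : p₀.1 ∈ e.baseSet := mem_baseSet_trivializationAt _ _ _
  have hproj : ContinuousAt (fun p : TotalSpace (EuclideanSpace ℝ (Fin n) →L[ℝ] F)
      (fun x => TangentSpace (𝓡 n) x →L[ℝ] V x) => p.1) p₀ :=
    (FiberBundle.continuous_proj _ _).continuousAt
  have hvec : ∀ w : EuclideanSpace ℝ (Fin n), ContinuousAt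
      (fun y => TotalSpace.mk' (EuclideanSpace ℝ (Fin n)) y (e.symm y w)) p₀.1 := fun w =>
    (e.continuousOn_mk_symm w).continuousAt (e.open_baseSet.mem_nhds hp₀)
  have hA : ∀ w : EuclideanSpace ℝ (Fin n), ContinuousAt
      (fun p : TotalSpace (EuclideanSpace ℝ (Fin n) →L[ℝ] F)
        (fun x => TangentSpace (𝓡 n) x →L[ℝ] V x) => q p.1 (p.2 (e.symm p.1 w))) p₀ := by
    intro w
    have h1 : ContinuousAt (fun p : TotalSpace (EuclideanSpace ℝ (Fin n) →L[ℝ] F)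
        (fun x => TangentSpace (𝓡 n) x →L[ℝ] V x) =>
          TotalSpace.mk' F p.1 (p.2 (e.symm p.1 w))) p₀ :=
      ContinuousAt.clm_bundle_apply (𝕜 := ℝ) (F₁ := EuclideanSpace ℝ (Fin n)) (F₂ := F)
        (E₁ := fun x : M => TangentSpace (𝓡 n) x) (E₂ := V)
        (b := fun p : TotalSpace (EuclideanSpace ℝ (Fin n) →L[ℝ] F)
          (fun x => TangentSpace (𝓡 n) x →L[ℝ] V x) => p.1)
        (ϕ := fun p => p.2) (v := fun p => e.symm p.1 w)
        continuousAt_id ((hvec w).comp hproj)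
    exact hc.continuousAt.comp h1
  set bas := (EuclideanSpace.basisFun (Fin n) ℝ).toBasis
  have hgram : ∀ i j, ContinuousAt (fun y =>
      (Matrix.of fun i j => inner ℝ (e.symm y (bas i)) (e.symm y (bas j)) :
        Matrix (Fin n) (Fin n) ℝ) i j) p₀.1 := fun i j =>
    ContinuousAt.inner_bundle (F := EuclideanSpace ℝ (Fin n))
      (E := fun x : M => TangentSpace (𝓡 n) x) (b := fun y => y) (hvec (bas i)) (hvec (bas j))
  have hbasis : ∀ y ∈ e.baseSet, ∃ b : Module.Basis (Fin n) ℝ (TangentSpace (𝓡 n) y),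
      ∀ i, b i = e.symm y (bas i) := fun y hy =>
    ⟨bas.map (e.linearEquivAt ℝ y hy).symm, fun i => by simp⟩
  have hdet : (Matrix.of fun i j => inner ℝ (e.symm p₀.1 (bas i)) (e.symm p₀.1 (bas j)) :
        Matrix (Fin n) (Fin n) ℝ).det ≠ 0 := by
    obtain ⟨b, hb⟩ := hbasis p₀.1 hp₀
    simp only [← hb]
    exact gram_det_ne_zero b ((stdOrthonormalBasis ℝ (TangentSpace (𝓡 n) p₀.1)).reindex
      ((stdOrthonormalBasis ℝ (TangentSpace (𝓡 n) p₀.1)).toBasis.indexEquiv b))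
  -- The chosen orthonormal bases need not vary continuously with the point. The sum is therefore
  -- rewritten in a local frame through the inverse Gram matrix, and the bilinear form is recovered
  -- by polarisation, as only `q` is known to be continuous.
  have key : ∀ᶠ p in 𝓝 p₀, gradNormSq (q p.1) p.2 = ∑ i, ∑ j,
      (Matrix.of fun i j => inner ℝ (e.symm p.1 (bas i)) (e.symm p.1 (bas j)) :
        Matrix (Fin n) (Fin n) ℝ)⁻¹ i j *
      ((q p.1 (p.2 (e.symm p.1 (bas i + bas j))) - q p.1 (p.2 (e.symm p.1 (bas i))) -
        q p.1 (p.2 (e.symm p.1 (bas j)))) / 2) := by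
    filter_upwards [hproj.eventually (e.open_baseSet.mem_nhds hp₀)] with p hp
    obtain ⟨b, hb⟩ := hbasis p.1 hp
    have hadd : ∀ i j, e.symm p.1 (bas i + bas j) = b i + b j := by
      intro i j
      rw [hb, hb]
      simp only [← e.symmₗ_apply (R := ℝ) hp, map_add]
    have := sum_orthonormalBasis_eq_sum_gram_inv b
      (stdOrthonormalBasis ℝ (TangentSpace (𝓡 n) p.1))
      ((B p.1).compl₁₂ (p.2 : TangentSpace (𝓡 n) p.1 →ₗ[ℝ] V p.1)
        (p.2 : TangentSpace (𝓡 n) p.1 →ₗ[ℝ] V p.1))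
    simp only [hadd, gradNormSq, hq]
    simp only [← hb]
    refine (Eq.trans ?_ this).trans ?_
    · rfl
    · refine Finset.sum_congr rfl fun i _ => Finset.sum_congr rfl fun j _ => ?_
      congr 1
      simp only [LinearMap.compl₁₂_apply, ContinuousLinearMap.coe_coe, map_add,
        LinearMap.add_apply]
      rw [hB _ (p.2 (b j)) (p.2 (b i))]
      ring
  refine ContinuousAt.congr ?_ (key.mono fun _ h => h.symm)
  refine tendsto_finsetSum _ fun i _ => tendsto_finsetSum _ fun j _ => ?_
  refine ContinuousAt.mul ?_ ((((hA _).sub (hA _)).sub (hA _)).div_const 2)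
  exact (ContinuousAt.matrix_nonsing_inv_apply (x := p₀.1) hgram hdet i j).comp
    (f := fun p : TotalSpace (EuclideanSpace ℝ (Fin n) →L[ℝ] F)
      (fun x => TangentSpace (𝓡 n) x →L[ℝ] V x) => p.1) hproj

end TotalSpace

/-! ### Smoothness of matrix inversion -/

section MatrixInverse

variable {ι : Type*} [Fintype ι] [DecidableEq ι]

theorem ContDiff.matrix_det {E : Type*} [NormedAddCommGroup E] [NormedSpace ℝ E]
    {A : E → Matrix ι ι ℂ} (hA : ∀ i j, ContDiff ℝ ∞ fun y => A y i j) :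
    ContDiff ℝ ∞ fun y => (A y).det := by
  simp only [Matrix.det_apply']
  exact ContDiff.sum fun σ _ => contDiff_const.mul (contDiff_prod fun i _ => hA _ _)

theorem contDiffAt_matrix_inv_apply (A₀ : ι → ι → ℂ) (h0 : (Matrix.of A₀).det ≠ 0) (i j : ι) :
    ContDiffAt ℝ ∞ (fun A : ι → ι → ℂ => (Matrix.of A)⁻¹ i j) A₀ := by
  have hent : ∀ i j, ContDiff ℝ ∞ fun A : ι → ι → ℂ => A i j := fun i j => by fun_prop
  have hdet : ContDiff ℝ ∞ fun A : ι → ι → ℂ => (Matrix.of A).det := ContDiff.matrix_det hent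
  have hadj : ContDiff ℝ ∞ fun A : ι → ι → ℂ => (Matrix.of A).adjugate i j := by
    simp only [Matrix.adjugate_apply]
    refine ContDiff.matrix_det fun k l => ?_
    simp only [Matrix.updateRow_apply]
    split_ifs
    · exact contDiff_const
    · exact hent k l
  simp only [Matrix.inv_def, Matrix.smul_apply, smul_eq_mul, Ring.inverse_eq_inv']
  exact (hdet.contDiffAt.inv h0).mul hadj.contDiffAt

end MatrixInverse

/-! ### Measurable sections under continuous maps -/

section Measurability

/-- `Φ` is controlled only over `U`; its extension by zero is Borel on the whole total space, and
the two agree along the section for the measure restricted to `U`. -/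
theorem AEMeasurableSection.comp_continuousOn {M F : Type*} {V : M → Type*} [MeasurableSpace M]
    [TopologicalSpace M] [OpensMeasurableSpace M] [TopologicalSpace F]
    [TopologicalSpace (TotalSpace F V)] [∀ x, TopologicalSpace (V x)] [FiberBundle F V]
    {μ : Measure M} {u : ∀ x, V x} (hu : AEMeasurableSection F μ u)
    {Y : Type*} [TopologicalSpace Y] [Zero Y] [MeasurableSpace Y] [BorelSpace Y]
    {U : Set M} (hU : IsOpen U) {Φ : TotalSpace F V → Y}
    (hΦ : ContinuousOn Φ (TotalSpace.proj ⁻¹' U)) :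
    AEMeasurable (fun x => Φ (TotalSpace.mk' F x (u x))) (μ.restrict U) := by
  classical
  let _ : MeasurableSpace (TotalSpace F V) := borel _
  have : BorelSpace (TotalSpace F V) := ⟨rfl⟩
  have hopen : IsOpen (TotalSpace.proj ⁻¹' U : Set (TotalSpace F V)) :=
    hU.preimage (FiberBundle.continuous_proj F V)
  have hmeas : Measurable ((TotalSpace.proj ⁻¹' U : Set (TotalSpace F V)).piecewise Φ 0) :=
    hΦ.measurable_piecewise continuousOn_const hopen.measurableSet
  have hcomp := (hmeas.comp_aemeasurable (show AEMeasurable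
    (fun x => TotalSpace.mk' F x (u x)) μ from hu)).restrict (s := U)
  refine hcomp.congr ?_
  filter_upwards [ae_restrict_mem hU.measurableSet] with x hx
  simp only [Function.comp]
  rw [Set.piecewise_eq_of_mem _ _ _ (show _ ∈ TotalSpace.proj ⁻¹' U from hx)]

end Measurability

/-! ### Hermitian metrics: algebra and continuity on the total space -/

section Hermitian

variable {n N : ℕ} {M : Type*} [TopologicalSpace M] [ChartedSpace (EuclideanSpace ℝ (Fin n)) M]
  {V : M → Type*} [TopologicalSpace (TotalSpace (EuclideanSpace ℂ (Fin N)) V)]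
  [∀ x, AddCommGroup (V x)] [∀ x, Module ℂ (V x)] [∀ x, TopologicalSpace (V x)]
  [FiberBundle (EuclideanSpace ℂ (Fin N)) V]

namespace HermitianMetric

variable (h : HermitianMetric n (EuclideanSpace ℂ (Fin N)) V)

/-- The real bilinear form `Re h`. -/
def reForm (x : M) : V x →ₗ[ℝ] V x →ₗ[ℝ] ℝ :=
  LinearMap.mk₂ ℝ (fun v w => (h.form x v w).re) (by simp) (by simp [← Complex.coe_smul])
    (by simp) (by simp [← Complex.coe_smul])

theorem reForm_apply (x : M) (v w : V x) : h.reForm x v w = (h.form x v w).re := rfl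

theorem reForm_self (x : M) (v : V x) : h.reForm x v v = h.normSq x v := rfl

theorem reForm_comm (x : M) (v w : V x) : h.reForm x v w = h.reForm x w v := by
  rw [reForm_apply, reForm_apply, ← h.conj_symm, Complex.conj_re]

theorem normSq_nonneg (x : M) (v : V x) : 0 ≤ h.normSq x v := by
  rcases eq_or_ne v 0 with rfl | hv
  · simp [normSq]
  · exact (h.pos x v hv).le

theorem normSq_zero (x : M) : h.normSq x (0 : V x) = 0 := by simp [normSq]

theorem normSq_sub (x : M) (v w : V x) :
    h.normSq x (v - w) = h.normSq x v - 2 * (h.form x v w).re + h.normSq x w := by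
  have := h.reForm_comm x v w
  rw [← h.reForm_apply]
  simp only [← reForm_self, map_sub, LinearMap.sub_apply]
  linarith

theorem normSq_add_le (x : M) (v w : V x) :
    h.normSq x (v + w) ≤ 2 * (h.normSq x v + h.normSq x w) := by
  have h1 := h.normSq_nonneg x (v - w)
  have := h.reForm_comm x v w
  simp only [← reForm_self, map_sub, map_add, LinearMap.sub_apply, LinearMap.add_apply] at h1 ⊢
  linarith

theorem normSq_smul (x : M) (c : ℂ) (v : V x) :
    h.normSq x (c • v) = Complex.normSq c * h.normSq x v := by
  simp only [normSq, LinearMap.map_smulₛₗ, LinearMap.smul_apply, map_smul, smul_eq_mul,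
    ← mul_assoc]
  rw [Complex.mul_conj, Complex.re_ofReal_mul]

theorem normSq_sum_le {ι : Type*} (s : Finset ι) (x : M) (v : ι → V x) :
    h.normSq x (∑ i ∈ s, v i) ≤ 2 ^ s.card * ∑ i ∈ s, h.normSq x (v i) := by
  classical
  induction s using Finset.induction_on with
  | empty => simp [normSq_zero]
  | insert a s ha ih =>
    rw [Finset.sum_insert ha, Finset.sum_insert ha, Finset.card_insert_of_notMem ha, pow_succ]
    have h1 := h.normSq_add_le x (v a) (∑ i ∈ s, v i)
    have h2 : h.normSq x (v a) ≤ 2 ^ s.card * h.normSq x (v a) :=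
      le_mul_of_one_le_left (h.normSq_nonneg _ _) (one_le_pow₀ one_le_two)
    linarith

theorem normSq_sum_smul_le {ι : Type*} (s : Finset ι) (x : M) (c : ι → ℂ) (v : ι → V x) :
    h.normSq x (∑ i ∈ s, c i • v i) ≤
      2 ^ s.card * ((∑ i ∈ s, Complex.normSq (c i)) * ∑ i ∈ s, h.normSq x (v i)) := by
  refine (h.normSq_sum_le s x _).trans (mul_le_mul_of_nonneg_left ?_ (by positivity))
  rw [Finset.mul_sum]
  refine Finset.sum_le_sum fun i hi => ?_
  rw [normSq_smul]
  exact mul_le_mul_of_nonneg_right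
    (Finset.single_le_sum (fun j _ => Complex.normSq_nonneg (c j)) hi) (h.normSq_nonneg _ _)

variable [VectorBundle ℂ (EuclideanSpace ℂ (Fin N)) V]
  [VectorBundle ℝ (EuclideanSpace ℂ (Fin N)) V]
  [ContMDiffVectorBundle ∞ (EuclideanSpace ℂ (Fin N)) V (𝓡 n)]

omit [VectorBundle ℂ (EuclideanSpace ℂ (Fin N)) V] in
theorem _root_.contMDiffOn_mk_symm_trivializationAt (x₀ : M) (w : EuclideanSpace ℂ (Fin N)) :
    ContMDiffOn (𝓡 n) ((𝓡 n).prod 𝓘(ℝ, EuclideanSpace ℂ (Fin N))) ∞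
      (fun y => TotalSpace.mk' (EuclideanSpace ℂ (Fin N)) y
        ((trivializationAt (EuclideanSpace ℂ (Fin N)) V x₀).symm y w))
      (trivializationAt (EuclideanSpace ℂ (Fin N)) V x₀).baseSet := by
  set e := trivializationAt (EuclideanSpace ℂ (Fin N)) V x₀
  have h1 := e.contMDiffOn_symm (n := ∞) (IB := 𝓡 n)
  have h2 : ContMDiffOn (𝓡 n) ((𝓡 n).prod 𝓘(ℝ, EuclideanSpace ℂ (Fin N))) ∞
      (fun y => e.toOpenPartialHomeomorph.symm (y, w)) e.baseSet :=
    h1.comp (contMDiff_id.prodMk contMDiff_const).contMDiffOn fun y hy => by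
      simpa [e.target_eq] using hy
  exact h2.congr fun y hy => e.mk_symm hy w

omit [ContMDiffVectorBundle ∞ (EuclideanSpace ℂ (Fin N)) V (𝓡 n)]
  [ChartedSpace (EuclideanSpace ℝ (Fin n)) M]
  [VectorBundle ℝ (EuclideanSpace ℂ (Fin N)) V] in
theorem _root_.eq_sum_trivializationAt_smul (x₀ : M)
    (p : TotalSpace (EuclideanSpace ℂ (Fin N)) V)
    (hp : p.1 ∈ (trivializationAt (EuclideanSpace ℂ (Fin N)) V x₀).baseSet) :
    p.2 = ∑ m, (trivializationAt (EuclideanSpace ℂ (Fin N)) V x₀ p).2 m •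
      (trivializationAt (EuclideanSpace ℂ (Fin N)) V x₀).symm p.1
        (EuclideanSpace.single m (1 : ℂ)) := by
  set e := trivializationAt (EuclideanSpace ℂ (Fin N)) V x₀
  have h1 : e.symm p.1 (e p).2 = p.2 := e.symm_proj_apply p hp
  have h2 : (e p).2 = ∑ m, (e p).2 m • EuclideanSpace.single m (1 : ℂ) := by
    have := (EuclideanSpace.basisFun (Fin N) ℂ).sum_repr (e p).2
    simpa using this.symm
  have h3 := congrArg (e.symmₗ ℂ p.1) h2
  simp only [map_sum, map_smul] at h3
  simp only [e.symmₗ_apply (R := ℂ) hp] at h3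
  rw [← h3, h1]

/-- Pairing with a smooth section is continuous on the total space. -/
theorem continuousOn_form {U : Set M} (hU : IsOpen U) {σ : ∀ x, V x}
    (hσ : ContMDiffOn (𝓡 n) ((𝓡 n).prod 𝓘(ℝ, EuclideanSpace ℂ (Fin N))) ∞
      (fun x => TotalSpace.mk' (EuclideanSpace ℂ (Fin N)) x (σ x)) U) :
    ContinuousOn (fun p : TotalSpace (EuclideanSpace ℂ (Fin N)) V => h.form p.1 (σ p.1) p.2)
      (TotalSpace.proj ⁻¹' U) := by
  intro p₀ hp₀
  refine ContinuousAt.continuousWithinAt ?_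
  set e := trivializationAt (EuclideanSpace ℂ (Fin N)) V p₀.1
  have hmem : p₀.1 ∈ e.baseSet := mem_baseSet_trivializationAt _ _ _
  have hproj : ContinuousAt
      (fun p : TotalSpace (EuclideanSpace ℂ (Fin N)) V => p.1) p₀ :=
    (FiberBundle.continuous_proj _ _).continuousAt
  -- The metric is known to be smooth only along sections. Expanding the fibre variable in a local
  -- frame leaves pairings of two smooth sections, which depend on the base point alone.
  have key : ∀ᶠ p in 𝓝 p₀, h.form p.1 (σ p.1) p.2 =
      ∑ m, (e p).2 m * h.form p.1 (σ p.1) (e.symm p.1 (EuclideanSpace.single m (1 : ℂ))) := by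
    filter_upwards [hproj.eventually (e.open_baseSet.mem_nhds hmem)] with p hp
    conv_lhs => rw [eq_sum_trivializationAt_smul p₀.1 p hp]
    simp only [map_sum, map_smul, smul_eq_mul, e]
  refine ContinuousAt.congr ?_ (key.mono fun _ h => h.symm)
  refine tendsto_finsetSum _ fun m _ => ContinuousAt.mul ?_ ?_
  · have h1 : ContinuousAt e p₀ := e.continuousAt (e.mem_source.2 hmem)
    have h2 : Continuous fun z : M × EuclideanSpace ℂ (Fin N) => z.2 m := by fun_prop
    exact h2.continuousAt.comp h1
  · have h1 := h.smooth (U ∩ e.baseSet) (hU.inter e.open_baseSet) σ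
      (fun y => e.symm y (EuclideanSpace.single m (1 : ℂ))) (hσ.mono Set.inter_subset_left)
      ((contMDiffOn_mk_symm_trivializationAt p₀.1 _).mono Set.inter_subset_right)
    exact ((h1.continuousOn.continuousAt
      ((hU.inter e.open_baseSet).mem_nhds ⟨hp₀, hmem⟩))).comp
        (f := fun p : TotalSpace (EuclideanSpace ℂ (Fin N)) V => p.1) hproj

/-- Conjugate linearity allows the first argument to be expanded in a local frame, which leaves
pairings with smooth sections, covered by `continuousOn_form`. -/
theorem continuous_normSq :
    Continuous (fun p : TotalSpace (EuclideanSpace ℂ (Fin N)) V => h.normSq p.1 p.2) := by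
  refine continuous_iff_continuousAt.2 fun p₀ => ?_
  set e := trivializationAt (EuclideanSpace ℂ (Fin N)) V p₀.1
  have hmem : p₀.1 ∈ e.baseSet := mem_baseSet_trivializationAt _ _ _
  have hproj : ContinuousAt
      (fun p : TotalSpace (EuclideanSpace ℂ (Fin N)) V => p.1) p₀ :=
    (FiberBundle.continuous_proj _ _).continuousAt
  have key : ∀ᶠ p in 𝓝 p₀, h.normSq p.1 p.2 =
      (∑ m, (starRingEnd ℂ) ((e p).2 m) *
        h.form p.1 (e.symm p.1 (EuclideanSpace.single m (1 : ℂ))) p.2).re := by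
    filter_upwards [hproj.eventually (e.open_baseSet.mem_nhds hmem)] with p hp
    have h1 : h.form p.1 p.2 = ∑ m, (starRingEnd ℂ) ((e p).2 m) •
        h.form p.1 (e.symm p.1 (EuclideanSpace.single m (1 : ℂ))) := by
      conv_lhs => rw [eq_sum_trivializationAt_smul p₀.1 p hp]
      simp only [map_sum, LinearMap.map_smulₛₗ, e]
    simp only [normSq, h1, LinearMap.sum_apply, LinearMap.smul_apply, smul_eq_mul]
  refine ContinuousAt.congr ?_ (key.mono fun _ h => h.symm)
  refine Complex.continuous_re.continuousAt.comp
    (tendsto_finsetSum _ fun m _ => ContinuousAt.mul ?_ ?_)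
  · have h1 : ContinuousAt e p₀ := e.continuousAt (e.mem_source.2 hmem)
    have h2 : Continuous fun z : M × EuclideanSpace ℂ (Fin N) => (starRingEnd ℂ) (z.2 m) := by
      fun_prop
    exact h2.continuousAt.comp h1
  · exact (h.continuousOn_form e.open_baseSet
      (contMDiffOn_mk_symm_trivializationAt p₀.1 _)).continuousAt
      ((e.open_baseSet.preimage (FiberBundle.continuous_proj _ _)).mem_nhds hmem)

end HermitianMetric

end Hermitian

/-! ### Coordinates in a GBG chart: bounds, smoothness, measurability -/

section Coordinates

variable {n N : ℕ} {M : Type*} [MetricSpace M]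
  [ChartedSpace (EuclideanSpace ℝ (Fin n)) M] {V : M → Type*}
  [TopologicalSpace (TotalSpace (EuclideanSpace ℂ (Fin N)) V)]
  [∀ x, AddCommGroup (V x)] [∀ x, Module ℂ (V x)] [∀ x, TopologicalSpace (V x)]
  [FiberBundle (EuclideanSpace ℂ (Fin N)) V]
  {h : HermitianMetric n (EuclideanSpace ℂ (Fin N)) V}

namespace GBG

variable (G : GBG h)

theorem sum_smul_frame (x y : M) (c : Fin N → ℂ) :
    ∑ i, c i • G.frame x i y = G.triv x y (WithLp.toLp 2 c) := by
  have h2 : WithLp.toLp 2 c = ∑ m, c m • EuclideanSpace.single m (1 : ℂ) := by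
    have := (EuclideanSpace.basisFun (Fin N) ℂ).sum_repr (WithLp.toLp 2 c)
    simpa using this.symm
  rw [h2, map_sum]
  simp only [map_smul, frame]

theorem sum_coord_smul_frame (x : M) (u : ∀ y, V y) (y : M) :
    ∑ i, G.coord x u i y • G.frame x i y = u y := by
  rw [sum_smul_frame]
  exact (G.triv x y).apply_symm_apply (u y)

theorem const_pos : 0 < G.const := by linarith [G.one_le_const]

theorem sum_normSq_le {x y : M} (hy : y ∈ Metric.ball x G.radius) (c : Fin N → ℂ) :
    ∑ i, Complex.normSq (c i) ≤ G.const * h.normSq y (∑ i, c i • G.frame x i y) := by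
  have := G.lower x y hy (WithLp.toLp 2 c)
  rw [← sum_smul_frame, EuclideanSpace.norm_sq_eq, inv_mul_le_iff₀ G.const_pos] at this
  simpa [Complex.normSq_eq_norm_sq] using this

theorem normSq_sum_smul_frame_le {x y : M} (hy : y ∈ Metric.ball x G.radius) (c : Fin N → ℂ) :
    h.normSq y (∑ i, c i • G.frame x i y) ≤ G.const * ∑ i, Complex.normSq (c i) := by
  have := G.upper x y hy (WithLp.toLp 2 c)
  rw [← sum_smul_frame, EuclideanSpace.norm_sq_eq] at this
  simpa [Complex.normSq_eq_norm_sq] using this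

theorem sum_normSq_coord_le {x y : M} (hy : y ∈ Metric.ball x G.radius) (u : ∀ y, V y) :
    ∑ i, Complex.normSq (G.coord x u i y) ≤ G.const * h.normSq y (u y) := by
  have := G.sum_normSq_le hy fun i => G.coord x u i y
  rwa [sum_coord_smul_frame] at this

theorem normSq_coord_le {x y : M} (hy : y ∈ Metric.ball x G.radius) (u : ∀ y, V y) (i : Fin N) :
    Complex.normSq (G.coord x u i y) ≤ G.const * h.normSq y (u y) :=
  (Finset.single_le_sum (f := fun i => Complex.normSq (G.coord x u i y))
    (fun _ _ => Complex.normSq_nonneg _) (Finset.mem_univ i)).trans (G.sum_normSq_coord_le hy u)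

/-- The Gram matrix of the frame of a GBG chart. -/
noncomputable def gram (x y : M) : Matrix (Fin N) (Fin N) ℂ :=
  Matrix.of fun j i => h.form y (G.frame x j y) (G.frame x i y)

theorem gram_mulVec (x y : M) (c : Fin N → ℂ) :
    (G.gram x y).mulVec c = fun j => h.form y (G.frame x j y) (∑ i, c i • G.frame x i y) := by
  ext j
  simp only [Matrix.mulVec, dotProduct, gram, Matrix.of_apply, map_sum, map_smul, smul_eq_mul]
  exact Finset.sum_congr rfl fun _ _ => mul_comm _ _

/-- A kernel vector c gives v = ∑ c_i e^i with h(e^j, v) = 0 for all j. Hence h(v, v) = 0, so v = 0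
by positivity, and c = 0 because the frame is a basis. -/
theorem gram_det_ne_zero (x y : M) : (G.gram x y).det ≠ 0 := by
  intro hdet
  obtain ⟨c, hc0, hc⟩ := Matrix.exists_mulVec_eq_zero_iff.2 hdet
  rw [gram_mulVec] at hc
  set v := ∑ i, c i • G.frame x i y with hv
  have hvv : h.form y v v = 0 := by
    conv_lhs => enter [1]; rw [hv]
    simp only [map_sum, LinearMap.map_smulₛₗ, LinearMap.sum_apply, LinearMap.smul_apply]
    exact Finset.sum_eq_zero fun j _ => by rw [congrFun hc j]; simp
  have hv0 : v = 0 := by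
    by_contra hne
    have := h.pos y v hne
    simp [hvv] at this
  rw [hv, sum_smul_frame, LinearEquiv.map_eq_zero_iff] at hv0
  exact hc0 (by simpa using congrArg WithLp.ofLp hv0)

/-- A GBG chart is given fibre by fibre, and only its frame is assumed smooth. Solving the linear
system for the pairings h(e^j, u) expresses u_i through quantities whose regularity is known. -/
theorem coord_eq (x : M) (u : ∀ y, V y) (i : Fin N) (y : M) :
    G.coord x u i y =
      ∑ j, (G.gram x y)⁻¹ i j * h.form y (G.frame x j y) (u y) := by
  have h1 := G.gram_mulVec x y fun i => G.coord x u i y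
  rw [sum_coord_smul_frame] at h1
  have h2 : (G.gram x y)⁻¹.mulVec ((G.gram x y).mulVec fun i => G.coord x u i y) =
      fun i => G.coord x u i y := by
    rw [Matrix.mulVec_mulVec, Matrix.nonsing_inv_mul _ (G.gram_det_ne_zero x y).isUnit,
      Matrix.one_mulVec]
  rw [h1] at h2
  exact (congrFun h2 i).symm

theorem contMDiffOn_gram_inv (x : M) (i j : Fin N) :
    ContMDiffOn (𝓡 n) 𝓘(ℝ, ℂ) ∞ (fun y => (G.gram x y)⁻¹ i j) (Metric.ball x G.radius) := by
  intro y hy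
  have hA : ContMDiffWithinAt (𝓡 n) 𝓘(ℝ, Fin N → Fin N → ℂ) ∞
      (fun y => fun i j => G.gram x y i j) (Metric.ball x G.radius) y := by
    refine contMDiffWithinAt_pi_space.2 fun i => contMDiffWithinAt_pi_space.2 fun j => ?_
    exact h.smooth _ Metric.isOpen_ball _ _ (G.smooth x i) (G.smooth x j) y hy
  exact ContDiffAt.comp_contMDiffWithinAt (f := fun y => fun i j => G.gram x y i j)
    (contDiffAt_matrix_inv_apply _ (G.gram_det_ne_zero x y) i j) hA

theorem contMDiffOn_coord (x : M) {u : ∀ y, V y}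
    (hu : ContMDiffOn (𝓡 n) ((𝓡 n).prod 𝓘(ℝ, EuclideanSpace ℂ (Fin N))) ∞
      (fun y => TotalSpace.mk' (EuclideanSpace ℂ (Fin N)) y (u y)) (Metric.ball x G.radius))
    (i : Fin N) :
    ContMDiffOn (𝓡 n) 𝓘(ℝ, ℂ) ∞ (G.coord x u i) (Metric.ball x G.radius) := by
  have h1 : G.coord x u i = fun y =>
      ∑ j, (G.gram x y)⁻¹ i j * h.form y (G.frame x j y) (u y) := funext (G.coord_eq x u i)
  rw [h1]
  refine contMDiffOn_finsetSum fun j _ => ?_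
  have hmul : ContDiff ℝ ∞ fun z : ℂ × ℂ => z.1 * z.2 := contDiff_fst.mul contDiff_snd
  exact hmul.contMDiff.comp_contMDiffOn ((G.contMDiffOn_gram_inv x i j).prodMk_space
    (h.smooth _ Metric.isOpen_ball _ _ (G.smooth x j) hu))

variable [MeasurableSpace M] [BorelSpace M]
  [VectorBundle ℂ (EuclideanSpace ℂ (Fin N)) V]
  [VectorBundle ℝ (EuclideanSpace ℂ (Fin N)) V]
  [ContMDiffVectorBundle ∞ (EuclideanSpace ℂ (Fin N)) V (𝓡 n)]

theorem aemeasurable_coord {μ : Measure M} (x : M) {u : ∀ y, V y}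
    (hu : AEMeasurableSection (EuclideanSpace ℂ (Fin N)) μ u) (i : Fin N) :
    AEMeasurable (G.coord x u i) (μ.restrict (Metric.ball x G.radius)) := by
  have h1 : G.coord x u i = fun y =>
      ∑ j, (G.gram x y)⁻¹ i j * h.form y (G.frame x j y) (u y) := funext (G.coord_eq x u i)
  rw [h1]
  refine Finset.aemeasurable_fun_sum _ fun j _ => ?_
  exact ((G.contMDiffOn_gram_inv x i j).continuousOn.aemeasurable
    Metric.isOpen_ball.measurableSet).mul (hu.comp_continuousOn Metric.isOpen_ball
      (h.continuousOn_form Metric.isOpen_ball (G.smooth x j)))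

end GBG

variable [MeasurableSpace M] [BorelSpace M]
  [VectorBundle ℂ (EuclideanSpace ℂ (Fin N)) V]
  [VectorBundle ℝ (EuclideanSpace ℂ (Fin N)) V]
  [ContMDiffVectorBundle ∞ (EuclideanSpace ℂ (Fin N)) V (𝓡 n)]

theorem HermitianMetric.aemeasurable_normSq (h : HermitianMetric n (EuclideanSpace ℂ (Fin N)) V)
    {μ : Measure M} {u : ∀ y, V y}
    (hu : AEMeasurableSection (EuclideanSpace ℂ (Fin N)) μ u) :
    AEMeasurable (fun x => h.normSq x (u x)) μ := by
  have := hu.comp_continuousOn isOpen_univ h.continuous_normSq.continuousOn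
  rwa [Measure.restrict_univ] at this

/-- The expansion |s|² - 2 Re h(s, u) + |u|² avoids subtraction of sections: for smooth `s`, each
term is a continuous function evaluated along `s` or `u`. -/
theorem HermitianMetric.aemeasurable_normSq_sub
    (h : HermitianMetric n (EuclideanSpace ℂ (Fin N)) V)
    {μ : Measure M} {s u : ∀ y, V y}
    (hs : ContMDiff (𝓡 n) ((𝓡 n).prod 𝓘(ℝ, EuclideanSpace ℂ (Fin N))) ∞
      (fun y => TotalSpace.mk' (EuclideanSpace ℂ (Fin N)) y (s y)))
    (hu : AEMeasurableSection (EuclideanSpace ℂ (Fin N)) μ u) :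
    AEMeasurable (fun x => h.normSq x (s x - u x)) μ := by
  simp only [h.normSq_sub]
  have h1 : AEMeasurable (fun x => h.form x (s x) (u x)) μ := by
    have := hu.comp_continuousOn isOpen_univ
      (h.continuousOn_form isOpen_univ hs.contMDiffOn)
    rwa [Measure.restrict_univ] at this
  have h2 : Measurable fun x => h.normSq x (s x) :=
    (h.continuous_normSq.comp hs.continuous).measurable
  exact (h2.aemeasurable.sub ((Complex.measurable_re.comp_aemeasurable h1).const_mul 2)).add
    (h.aemeasurable_normSq hu)

theorem HermitianMetric.aemeasurable_gradNormSq [IsManifold (𝓡 n) ∞ M]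
    [RiemannianBundle (fun x : M => TangentSpace (𝓡 n) x)]
    [IsContMDiffRiemannianBundle (𝓡 n) ∞ (EuclideanSpace ℝ (Fin n))
      (fun x : M => TangentSpace (𝓡 n) x)]
    [∀ x, IsTopologicalAddGroup (V x)] [∀ x, ContinuousSMul ℝ (V x)]
    (h : HermitianMetric n (EuclideanSpace ℂ (Fin N)) V)
    {μ : Measure M} {du : ∀ x, TangentSpace (𝓡 n) x →L[ℝ] V x}
    (hu : AEMeasurableSection (EuclideanSpace ℝ (Fin n) →L[ℝ] (EuclideanSpace ℂ (Fin N)))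
    (V := fun x => TangentSpace (𝓡 n) x →L[ℝ] V x) μ du) :
    AEMeasurable (fun x => gradNormSq (h.normSq x) (du x)) μ := by
  have := hu.comp_continuousOn isOpen_univ
    (continuous_gradNormSq (n := n) h.normSq h.reForm h.reForm_comm
      (fun x v => (h.reForm_self x v).symm) h.continuous_normSq).continuousOn
  rwa [Measure.restrict_univ] at this

end Coordinates

/-! ### The complex Leibniz rule -/

section Leibniz

variable {n N : ℕ} {M : Type*} [TopologicalSpace M]
  [ChartedSpace (EuclideanSpace ℝ (Fin n)) M] {V : M → Type*}
  [TopologicalSpace (TotalSpace (EuclideanSpace ℂ (Fin N)) V)]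
  [∀ x, AddCommGroup (V x)] [∀ x, Module ℂ (V x)] [∀ x, TopologicalSpace (V x)]
  [FiberBundle (EuclideanSpace ℂ (Fin N)) V]
  [VectorBundle ℂ (EuclideanSpace ℂ (Fin N)) V] [VectorBundle ℝ (EuclideanSpace ℂ (Fin N)) V]

omit [VectorBundle ℝ (EuclideanSpace ℂ (Fin N)) V] in
-- The trivialisation is complex linear on fibres, so multiplication by `c` becomes one fixed linear
-- map of ℂ^N.
theorem MDifferentiableAt.const_complex_smul_section {σ : ∀ x, V x} {x : M}
    (hσ : MDifferentiableAt (𝓡 n) ((𝓡 n).prod 𝓘(ℝ, EuclideanSpace ℂ (Fin N)))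
        (fun y => TotalSpace.mk' (EuclideanSpace ℂ (Fin N)) y (σ y)) x) (c : ℂ) :
    MDifferentiableAt (𝓡 n) ((𝓡 n).prod 𝓘(ℝ, EuclideanSpace ℂ (Fin N)))
        (fun y => TotalSpace.mk' (EuclideanSpace ℂ (Fin N)) y (c • σ y)) x := by
  rw [mdifferentiableAt_section] at hσ ⊢
  set e := trivializationAt (EuclideanSpace ℂ (Fin N)) V x
  have h1 : DifferentiableAt ℝ (fun w : EuclideanSpace ℂ (Fin N) => c • w)
    (e ⟨x, σ x⟩).2 := by fun_prop
  refine (DifferentiableAt.comp_mdifferentiableAt (f := fun y => (e ⟨y, σ y⟩).2)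
    h1 hσ).congr_of_eventuallyEq ?_
  filter_upwards [e.open_baseSet.mem_nhds (mem_baseSet_trivializationAt _ V x)] with y hy
  exact (e.linear ℂ hy).map_smul c (σ y)

variable [∀ x, IsTopologicalAddGroup (V x)] [∀ x, ContinuousSMul ℝ (V x)]
    (conn : CovariantDerivative (𝓡 n) (EuclideanSpace ℂ (Fin N)) V)

/-- The Leibniz rule for a complex linear connection and a complex valued function. -/
theorem CovariantDerivative.complex_leibniz
    (conn_complex : ∀ (σ : ∀ x, V x) (x : M),
      MDifferentiableAt (𝓡 n) ((𝓡 n).prod 𝓘(ℝ, EuclideanSpace ℂ (Fin N)))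
        (fun y => TotalSpace.mk' (EuclideanSpace ℂ (Fin N)) y (σ y)) x →
      ∀ X : TangentSpace (𝓡 n) x, conn (fun y => Complex.I • σ y) x X = Complex.I • conn σ x X)
    {σ : ∀ x, V x} {f : M → ℂ} {x : M}
    (hσ : MDifferentiableAt (𝓡 n) ((𝓡 n).prod 𝓘(ℝ, EuclideanSpace ℂ (Fin N)))
        (fun y => TotalSpace.mk' (EuclideanSpace ℂ (Fin N)) y (σ y)) x)
    (hf : MDifferentiableAt (𝓡 n) 𝓘(ℝ, ℂ) f x) (X : TangentSpace (𝓡 n) x) :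
    MDifferentiableAt (𝓡 n) ((𝓡 n).prod 𝓘(ℝ, EuclideanSpace ℂ (Fin N)))
        (fun y => TotalSpace.mk' (EuclideanSpace ℂ (Fin N)) y (f y • σ y)) x ∧
    conn (fun y => f y • σ y) x X =
      (show ℂ from mfderiv (𝓡 n) 𝓘(ℝ, ℂ) f x X) • σ x + f x • conn σ x X := by
  have hre : HasMFDerivAt (𝓡 n) 𝓘(ℝ, ℝ) (fun y => (f y).re) x
      (Complex.reCLM.comp (mfderiv (𝓡 n) 𝓘(ℝ, ℂ) f x)) :=
    HasMFDerivAt.comp x Complex.reCLM.hasMFDerivAt hf.hasMFDerivAt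
  have him : HasMFDerivAt (𝓡 n) 𝓘(ℝ, ℝ) (fun y => (f y).im) x
      (Complex.imCLM.comp (mfderiv (𝓡 n) 𝓘(ℝ, ℂ) f x)) :=
    HasMFDerivAt.comp x Complex.imCLM.hasMFDerivAt hf.hasMFDerivAt
  have hIσ := hσ.const_complex_smul_section Complex.I
  have h1 := hre.mdifferentiableAt.smul_section hσ
  have h2 := him.mdifferentiableAt.smul_section hIσ
  -- The connection obeys the Leibniz rule for real functions; splitting `f` into real and imaginary
  -- parts reduces to it, and complex linearity handles the section I • σ.
  have hdec : (fun y => f y • σ y) =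
      ((fun y => (f y).re) • σ) + ((fun y => (f y).im) • fun y => Complex.I • σ y) := by
    funext y
    simp only [Pi.add_apply, Pi.smul_apply']
    rw [← Complex.coe_smul, ← Complex.coe_smul, smul_smul, ← add_smul, Complex.re_add_im]
  have hC := conn.isCovariantDerivativeOnUniv
  refine ⟨by
    have := mdifferentiableAt_add_section h1 h2
    rw [← hdec] at this
    exact this, ?_⟩
  rw [hdec]
  have e1 : conn (((fun y => (f y).re) • σ) + ((fun y => (f y).im) • fun y => Complex.I • σ y)) x
      = _ := hC.add h1 h2
  have e2 : conn ((fun y => (f y).re) • σ) x = _ := hC.leibniz hσ hre.mdifferentiableAt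
  have e3 : conn ((fun y => (f y).im) • fun y => Complex.I • σ y) x = _ :=
    hC.leibniz hIσ him.mdifferentiableAt
  have e4 := conn_complex σ x hσ X
  have d1 : mvfderiv (𝓡 n) (fun y => (f y).re) x X =
      (show ℂ from mfderiv (𝓡 n) 𝓘(ℝ, ℂ) f x X).re := by
    rw [mvfderiv, hre.mfderiv]; rfl
  have d2 : mvfderiv (𝓡 n) (fun y => (f y).im) x X =
      (show ℂ from mfderiv (𝓡 n) 𝓘(ℝ, ℂ) f x X).im := by
    rw [mvfderiv, him.mfderiv]; rfl
  set z : ℂ := (show ℂ from mfderiv (𝓡 n) 𝓘(ℝ, ℂ) f x X)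
  rw [e1, e2, e3]
  calc _ = ((f x).re • conn σ x X + mvfderiv (𝓡 n) (fun y => (f y).re) x X • σ x) +
        ((f x).im • conn (fun y => Complex.I • σ y) x X +
          mvfderiv (𝓡 n) (fun y => (f y).im) x X • Complex.I • σ x) := rfl
    _ = z • σ x + f x • conn σ x X := by
      rw [e4, d1, d2]
      conv_rhs => rw [← Complex.re_add_im z, ← Complex.re_add_im (f x)]
      simp only [← Complex.coe_smul]
      module

end Leibniz

/-! ### Gradients of coordinates against the covariant derivative -/

section FrameGradient

/-- The differential of a complex valued function on a real manifold. -/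
noncomputable def complexDifferential {n : ℕ} {M : Type*} [TopologicalSpace M]
    [ChartedSpace (EuclideanSpace ℝ (Fin n)) M] (f : M → ℂ) (x : M) :
    TangentSpace (𝓡 n) x →L[ℝ] ℂ :=
  mfderiv (𝓡 n) 𝓘(ℝ, ℂ) f x

variable {n N : ℕ} {M : Type*} [MetricSpace M]
  [ChartedSpace (EuclideanSpace ℝ (Fin n)) M] {V : M → Type*}
  [TopologicalSpace (TotalSpace (EuclideanSpace ℂ (Fin N)) V)]
  [∀ x, AddCommGroup (V x)] [∀ x, Module ℂ (V x)] [∀ x, TopologicalSpace (V x)]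
  [FiberBundle (EuclideanSpace ℂ (Fin N)) V]
  [VectorBundle ℂ (EuclideanSpace ℂ (Fin N)) V] [VectorBundle ℝ (EuclideanSpace ℂ (Fin N)) V]
  [∀ x, IsTopologicalAddGroup (V x)] [∀ x, ContinuousSMul ℝ (V x)]
  {h : HermitianMetric n (EuclideanSpace ℂ (Fin N)) V} (G : GBG h)
  {conn : CovariantDerivative (𝓡 n) (EuclideanSpace ℂ (Fin N)) V}
  (conn_complex : ∀ (σ : ∀ x, V x) (x : M),
      MDifferentiableAt (𝓡 n) ((𝓡 n).prod 𝓘(ℝ, EuclideanSpace ℂ (Fin N)))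
        (fun y => TotalSpace.mk' (EuclideanSpace ℂ (Fin N)) y (σ y)) x →
      ∀ X : TangentSpace (𝓡 n) x, conn (fun y => Complex.I • σ y) x X = Complex.I • conn σ x X)

include conn_complex in
/-- A connection in the frame of a GBG chart. -/
theorem GBG.conn_eq_sum {x y : M} (hy : y ∈ Metric.ball x G.radius) {s : ∀ y, V y}
    (hs : ContMDiffOn (𝓡 n) ((𝓡 n).prod 𝓘(ℝ, EuclideanSpace ℂ (Fin N))) ∞
      (fun y => TotalSpace.mk' (EuclideanSpace ℂ (Fin N)) y (s y)) (Metric.ball x G.radius))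
    (X : TangentSpace (𝓡 n) y) :
    conn s y X = ∑ i, ((complexDifferential (n := n) (G.coord x s i) y X) • G.frame x i y +
      G.coord x s i y • conn (G.frame x i) y X) := by
  have hball : Metric.ball x G.radius ∈ 𝓝 y := Metric.isOpen_ball.mem_nhds hy
  have hl : ∀ i, _ := fun i => conn.complex_leibniz conn_complex
    (((G.smooth x i).contMDiffAt hball).mdifferentiableAt (by simp))
    (((G.contMDiffOn_coord x hs i).contMDiffAt hball).mdifferentiableAt (by simp)) X
  -- Additivity of the connection requires differentiable summands, so differentiability is carried
  -- through the induction.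
  have hsum : ∀ t : Finset (Fin N),
      MDifferentiableAt (𝓡 n) ((𝓡 n).prod 𝓘(ℝ, EuclideanSpace ℂ (Fin N)))
        (fun z => TotalSpace.mk' (EuclideanSpace ℂ (Fin N)) z
          ((∑ i ∈ t, fun z => G.coord x s i z • G.frame x i z : ∀ z, V z) z)) y ∧
      conn (∑ i ∈ t, fun z => G.coord x s i z • G.frame x i z) y X =
        ∑ i ∈ t, ((complexDifferential (n := n) (G.coord x s i) y X) • G.frame x i y +
          G.coord x s i y • conn (G.frame x i) y X) := by
    classical
    intro t
    induction t using Finset.induction_on with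
    | empty =>
      refine ⟨mdifferentiableAt_zeroSection .., ?_⟩
      simp only [Finset.sum_empty]
      have : conn 0 y = 0 := conn.isCovariantDerivativeOnUniv.zero
      rw [this]; rfl
    | insert a t ha ih =>
      rw [Finset.sum_insert ha, Finset.sum_insert ha]
      refine ⟨mdifferentiableAt_add_section (hl a).1 ih.1, ?_⟩
      rw [← ih.2]
      exact (congrArg (fun A => A X) (conn.isCovariantDerivativeOnUniv.add (hl a).1 ih.1)).trans
        (congrArg₂ (· + ·) (hl a).2 rfl)
  -- This identity holds at every point of `M`, since `triv x z` is an isomorphism even off the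
  -- ball; locality of the connection is not needed.
  have hs' : s = ∑ i, fun z => G.coord x s i z • G.frame x i z := by
    funext z
    rw [Finset.sum_apply, G.sum_coord_smul_frame]
  conv_lhs => rw [hs']
  exact (hsum Finset.univ).2

variable [RiemannianBundle (fun x : M => TangentSpace (𝓡 n) x)]

omit [∀ x, IsTopologicalAddGroup (V x)] [∀ x, ContinuousSMul ℝ (V x)]
  [VectorBundle ℂ (EuclideanSpace ℂ (Fin N)) V] [VectorBundle ℝ (EuclideanSpace ℂ (Fin N)) V] in
theorem HermitianMetric.gradNormSq_nonneg (h : HermitianMetric n (EuclideanSpace ℂ (Fin N)) V)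
    {x : M} (A : TangentSpace (𝓡 n) x →L[ℝ] V x) : 0 ≤ gradNormSq (h.normSq x) A :=
  Finset.sum_nonneg fun _ _ => h.normSq_nonneg _ _

omit [∀ x, ContinuousSMul ℝ (V x)]
  [VectorBundle ℂ (EuclideanSpace ℂ (Fin N)) V] [VectorBundle ℝ (EuclideanSpace ℂ (Fin N)) V] in
theorem HermitianMetric.gradNormSq_le_two_mul
    (h : HermitianMetric n (EuclideanSpace ℂ (Fin N)) V)
    {x : M} (A B : TangentSpace (𝓡 n) x →L[ℝ] V x) :
    gradNormSq (h.normSq x) A ≤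
      2 * (gradNormSq (h.normSq x) B + gradNormSq (h.normSq x) (A - B)) := by
  unfold gradNormSq
  rw [← Finset.sum_add_distrib, Finset.mul_sum]
  refine Finset.sum_le_sum fun i _ => ?_
  have := h.normSq_add_le x (B (stdOrthonormalBasis ℝ (TangentSpace (𝓡 n) x) i))
    ((A - B) (stdOrthonormalBasis ℝ (TangentSpace (𝓡 n) x) i))
  rwa [← add_apply, add_sub_cancel] at this

/-- The constant in the bound of the gradients of the coordinates of a section. -/
noncomputable def GBG.gradConst (G : GBG h) (C_G : ℝ) : ℝ :=
  2 * G.const * (1 + 2 ^ N * (G.const * (N * C_G ^ 2)))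

include conn_complex in
/-- The gradients of the coordinates of a section are controlled by the section and its
covariant derivative. -/
theorem GBG.gradNormSq_coord_le {C_G : ℝ}
    (grad_frame : ∀ (x : M) (i : Fin N), ∀ y ∈ Metric.ball x G.radius,
      √(gradNormSq (h.normSq y) (conn (G.frame x i) y)) ≤ C_G)
    {x y : M} (hy : y ∈ Metric.ball x G.radius) {s : ∀ y, V y}
    (hs : ContMDiffOn (𝓡 n) ((𝓡 n).prod 𝓘(ℝ, EuclideanSpace ℂ (Fin N))) ∞
      (fun y => TotalSpace.mk' (EuclideanSpace ℂ (Fin N)) y (s y)) (Metric.ball x G.radius))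
    (i : Fin N) :
    gradNormSq Complex.normSq (complexDifferential (n := n) (G.coord x s i) y) ≤
      G.gradConst C_G * (gradNormSq (h.normSq y) (conn s y) + h.normSq y (s y)) := by
  have hC := G.const_pos
  have hpt : ∀ X : TangentSpace (𝓡 n) y,
      Complex.normSq (complexDifferential (n := n) (G.coord x s i) y X) ≤
        2 * G.const * (h.normSq y (conn s y X) + 2 ^ N * ((G.const * h.normSq y (s y)) *
          ∑ j, h.normSq y (conn (G.frame x j) y X))) := by
    intro X
    set c : Fin N → ℂ := fun j => complexDifferential (n := n) (G.coord x s j) y X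
    -- The Leibniz expansion solved for ∑ ds_j(X) e^j. The lower frame bound then controls each
    -- ds_j(X).
    have h1 : ∑ j, c j • G.frame x j y =
        conn s y X + ∑ j, (-G.coord x s j y) • conn (G.frame x j) y X := by
      rw [G.conn_eq_sum conn_complex hy hs X, Finset.sum_add_distrib]
      simp [c]
    calc Complex.normSq (c i) ≤ ∑ j, Complex.normSq (c j) :=
          Finset.single_le_sum (f := fun j => Complex.normSq (c j))
            (fun _ _ => Complex.normSq_nonneg _) (Finset.mem_univ i)
      _ ≤ G.const * h.normSq y (∑ j, c j • G.frame x j y) := G.sum_normSq_le hy c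
      _ ≤ G.const * (2 * (h.normSq y (conn s y X) +
            2 ^ N * ((G.const * h.normSq y (s y)) *
              ∑ j, h.normSq y (conn (G.frame x j) y X)))) := by
          refine mul_le_mul_of_nonneg_left ?_ hC.le
          rw [h1]
          refine (h.normSq_add_le _ _ _).trans ?_
          gcongr
          refine (h.normSq_sum_smul_le _ _ _ _).trans ?_
          rw [Finset.card_univ, Fintype.card_fin]
          gcongr
          · exact Finset.sum_nonneg fun _ _ => h.normSq_nonneg _ _
          · simpa only [Complex.normSq_neg] using G.sum_normSq_coord_le hy s
      _ = _ := by ring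
  have hframe : ∀ j, gradNormSq (h.normSq y) (conn (G.frame x j) y) ≤ C_G ^ 2 := fun j =>
    (Real.sqrt_le_iff.1 (grad_frame x j y hy)).2
  have hs0 := h.normSq_nonneg y (s y)
  have hg0 := h.gradNormSq_nonneg (conn s y)
  calc gradNormSq Complex.normSq (complexDifferential (n := n) (G.coord x s i) y)
      ≤ 2 * G.const * (gradNormSq (h.normSq y) (conn s y) +
        2 ^ N * ((G.const * h.normSq y (s y)) *
          ∑ j, gradNormSq (h.normSq y) (conn (G.frame x j) y))) := by
        unfold gradNormSq
        rw [Finset.sum_comm, Finset.mul_sum, Finset.mul_sum, ← Finset.sum_add_distrib,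
          Finset.mul_sum]
        exact Finset.sum_le_sum fun a _ => hpt _
    _ ≤ 2 * G.const * (gradNormSq (h.normSq y) (conn s y) +
        2 ^ N * ((G.const * h.normSq y (s y)) * (N * C_G ^ 2))) := by
        gcongr
        refine (Finset.sum_le_sum fun j _ => hframe j).trans ?_
        simp
    _ ≤ _ := by
        unfold GBG.gradConst
        have : 0 ≤ 2 * G.const * (h.normSq y (s y)) := by positivity
        have : 0 ≤ 2 * G.const * (2 ^ N * (G.const * (N * C_G ^ 2))) *
          gradNormSq (h.normSq y) (conn s y) := by positivity
        linarith

end FrameGradient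

/-! ### Compactly supported smooth functions belong to H¹(M) -/

section CompactSupport

variable {n : ℕ} {M : Type*} [TopologicalSpace M]
  [ChartedSpace (EuclideanSpace ℝ (Fin n)) M] [IsManifold (𝓡 n) ∞ M]

omit [IsManifold (𝓡 n) ∞ M] in
theorem ContMDiff.trivial_section {f : M → ℂ} (hf : ContMDiff (𝓡 n) 𝓘(ℝ, ℂ) ∞ f) :
    ContMDiff (𝓡 n) ((𝓡 n).prod 𝓘(ℝ, ℂ)) ∞
      (fun x => TotalSpace.mk' ℂ (E := Trivial M ℂ) x (f x)) := by
  intro x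
  rw [contMDiffAt_section]
  exact hf x

/-- The differential of a smooth function is a continuous section of `T*M ⊗ ℂ`. -/
theorem ContMDiff.continuous_mfderiv_section {f : M → ℂ} (hf : ContMDiff (𝓡 n) 𝓘(ℝ, ℂ) ∞ f) :
    Continuous (fun x => TotalSpace.mk' (EuclideanSpace ℝ (Fin n) →L[ℝ] ℂ)
      (E := fun x => TangentSpace (𝓡 n) x →L[ℝ] Trivial M ℂ x) x
        (complexDifferential f x)) := by
  have : IsManifold (𝓡 n) 1 M := IsManifold.of_le (n := ∞) (by simp)
  refine continuous_iff_continuousAt.2 fun x₀ => ?_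
  rw [continuousAt_hom_bundle]
  refine ⟨continuousAt_id, ?_⟩
  have h1 := (ContMDiffAt.mfderiv_const (m := 0) (hf x₀) (by simp)).continuousAt
  refine h1.congr (Eventually.of_forall fun y => ?_)
  simp only [inTangentCoordinates, ContinuousLinearMap.inCoordinates,
    TangentBundle.continuousLinearMapAt_model_space]
  change _ = (Trivial.trivialization M ℂ).continuousLinearMapAt ℝ y ∘L _ ∘L _
  rw [Trivial.continuousLinearMapAt_trivialization]
  rfl

omit [IsManifold (𝓡 n) ∞ M] in
theorem gradNormSq_sub_self [RiemannianBundle (fun x : M => TangentSpace (𝓡 n) x)]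
     {W : Type*} [AddCommGroup W] [Module ℝ W] [TopologicalSpace W]
    [IsTopologicalAddGroup W] (q : W → ℝ) (hq : q 0 = 0) {x : M}
    (A : TangentSpace (𝓡 n) x →L[ℝ] W) : gradNormSq q (A - A) = 0 := by
  rw [sub_self]
  exact Finset.sum_eq_zero fun _ _ => hq

variable [RiemannianBundle (fun x : M => TangentSpace (𝓡 n) x)]
  [IsContMDiffRiemannianBundle (𝓡 n) ∞ (EuclideanSpace ℝ (Fin n))
      (fun x : M => TangentSpace (𝓡 n) x)]

theorem ContMDiff.continuous_gradNormSq_mfderiv {f : M → ℂ}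
    (hf : ContMDiff (𝓡 n) 𝓘(ℝ, ℂ) ∞ f) :
    Continuous fun x => gradNormSq Complex.normSq (complexDifferential (n := n) f x) := by
  have hc : Continuous fun p : TotalSpace ℂ (Trivial M ℂ) => Complex.normSq p.2 :=
    Complex.continuous_normSq.comp
      (continuous_snd.comp (Bundle.Trivial.homeomorphProd M ℂ).continuous)
  have h1 : Continuous fun p : TotalSpace (EuclideanSpace ℝ (Fin n) →L[ℝ] ℂ)
      (fun x => TangentSpace (𝓡 n) x →L[ℝ] Trivial M ℂ x) =>
        gradNormSq (W := Trivial M ℂ p.1) Complex.normSq p.2 :=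
    continuous_gradNormSq (n := n) (V := Trivial M ℂ) (fun _ z => Complex.normSq z)
    (fun _ => (innerₗ ℂ : ℂ →ₗ[ℝ] ℂ →ₗ[ℝ] ℝ))
    (fun _ v w => real_inner_comm (F := ℂ) w v)
    (fun _ v => by
      rw [Complex.normSq_eq_norm_sq]
      exact (real_inner_self_eq_norm_sq (F := ℂ) v).symm) hc
  refine continuous_iff_continuousAt.2 fun x => ?_
  have h2 := Tendsto.comp (continuous_iff_continuousAt.1 h1 _)
    (continuous_iff_continuousAt.1 hf.continuous_mfderiv_section x)
  exact h2

/-- The constant sequence `f` is an admissible approximation: compact support and finiteness of `μ`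
on compact sets make `f` and its differential square integrable. -/
theorem ContMDiff.isSobolevGradientFun [IsManifold (𝓡 n) 1 M] [MeasurableSpace M] [BorelSpace M]
    {μ : Measure M} [IsFiniteMeasureOnCompacts μ] {f : M → ℂ}
    (hf : ContMDiff (𝓡 n) 𝓘(ℝ, ℂ) ∞ f) (hsupp : HasCompactSupport f) :
    IsSobolevGradientFun μ f (complexDifferential (n := n) f) where
  measurable := by
    let _ : MeasurableSpace (TotalSpace ℂ (Trivial M ℂ)) := borel _
    have : BorelSpace (TotalSpace ℂ (Trivial M ℂ)) := ⟨rfl⟩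
    exact hf.trivial_section.continuous.measurable.aemeasurable
  measurable_grad := by
    let _ : MeasurableSpace (TotalSpace (EuclideanSpace ℝ (Fin n) →L[ℝ] ℂ)
      (fun x => TangentSpace (𝓡 n) x →L[ℝ] Trivial M ℂ x)) := borel _
    have : BorelSpace (TotalSpace (EuclideanSpace ℝ (Fin n) →L[ℝ] ℂ)
      (fun x => TangentSpace (𝓡 n) x →L[ℝ] Trivial M ℂ x)) := ⟨rfl⟩
    exact hf.continuous_mfderiv_section.measurable.aemeasurable
  approx := by
    refine ⟨fun _ => f, fun _ => hf.trivial_section, fun _ => ?_, fun _ => ?_, ?_, ?_⟩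
    · refine (Continuous.integrable_of_hasCompactSupport
        (Complex.continuous_normSq.comp hf.continuous) ?_).lintegral_lt_top
      exact hsupp.comp_left (map_zero _)
    · refine (Continuous.integrable_of_hasCompactSupport
        hf.continuous_gradNormSq_mfderiv ?_).lintegral_lt_top
      refine hsupp.mono' fun x hx' => ?_
      by_contra hx
      refine hx' ?_
      have h0 : f =ᶠ[𝓝 x] fun _ => (0 : ℂ) := notMem_tsupport_iff_eventuallyEq.1 hx
      have h1 : complexDifferential (n := n) f x = 0 := h0.mfderiv_eq.trans mfderiv_const
      change gradNormSq Complex.normSq (complexDifferential (n := n) f x) = 0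
      rw [h1]
      exact Finset.sum_eq_zero fun _ _ => Complex.normSq_zero
    · simp
    · refine tendsto_const_nhds.congr fun _ => ?_
      refine ((lintegral_congr fun x => ?_).trans lintegral_zero).symm
      exact (congrArg ENNReal.ofReal (gradNormSq_sub_self Complex.normSq
        Complex.normSq_zero (complexDifferential (n := n) f x))).trans ENNReal.ofReal_zero

end CompactSupport

/-! ### The Poincaré inequality for locally smooth functions -/

section Localization

variable {n : ℕ} {M : Type*} [MetricSpace M] [ChartedSpace (EuclideanSpace ℝ (Fin n)) M]
  [IsManifold (𝓡 n) ∞ M] [SecondCountableTopology M]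

/-- A smooth function on a ball agrees on a smaller ball with a smooth compactly supported
function. -/
theorem exists_contMDiff_hasCompactSupport_eqOn {x : M} {ρ a : ℝ} (haρ : a < ρ)
    (hcpt : IsCompact (Metric.closedBall x ρ)) {g : M → ℂ}
    (hg : ContMDiffOn (𝓡 n) 𝓘(ℝ, ℂ) ∞ g (Metric.ball x ρ)) :
    ∃ f : M → ℂ, ContMDiff (𝓡 n) 𝓘(ℝ, ℂ) ∞ f ∧ HasCompactSupport f ∧
      Set.EqOn f g (Metric.ball x a) := by
  have : LocallyCompactSpace M :=
    ChartedSpace.locallyCompactSpace (EuclideanSpace ℝ (Fin n)) M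
  -- The cut-off vanishes beyond radius b < ρ, so χg is smooth also at the boundary of the domain of
  -- `g`, where `g` itself is not controlled.
  obtain ⟨b, hab, hbρ⟩ := exists_between haρ
  obtain ⟨χ, hχ1, hχ0, -⟩ := exists_contMDiffMap_one_nhds_of_subset_interior (𝓡 n) (n := (⊤ : ℕ∞))
    (s := Metric.closedBall x a) (t := Metric.closedBall x b) Metric.isClosed_closedBall
    ((Metric.closedBall_subset_ball hab).trans Metric.ball_subset_interior_closedBall)
  refine ⟨fun y => χ y • g y, fun y => ?_, ?_, fun y hy => ?_⟩
  · by_cases hy : y ∈ Metric.ball x ρ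
    · exact (χ.contMDiff y).smul (hg.contMDiffAt (Metric.isOpen_ball.mem_nhds hy))
    · have hyb : (Metric.closedBall x b)ᶜ ∈ 𝓝 y :=
        Metric.isClosed_closedBall.isOpen_compl.mem_nhds fun h =>
          hy (Metric.closedBall_subset_ball hbρ h)
      refine (contMDiffAt_const (c := (0 : ℂ))).congr_of_eventuallyEq ?_
      filter_upwards [hyb] with z hz
      rw [hχ0 z hz, zero_smul]
  · refine HasCompactSupport.intro hcpt fun y hy => ?_
    rw [hχ0 y fun h => hy (Metric.closedBall_subset_closedBall hbρ.le h), zero_smul]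
  · have := hχ1.self_of_nhdsSet y (Metric.ball_subset_closedBall hy)
    simp only [this, one_smul]

variable [RiemannianBundle (fun x : M => TangentSpace (𝓡 n) x)]
  [IsContMDiffRiemannianBundle (𝓡 n) ∞ (EuclideanSpace ℝ (Fin n))
      (fun x : M => TangentSpace (𝓡 n) x)]
  [IsManifold (𝓡 n) 1 M] [MeasurableSpace M] [BorelSpace M]

/-- The Poincaré inequality for functions that are only smooth near the ball. -/
theorem poincare_of_contMDiffOn {μ : Measure M} [IsFiniteMeasureOnCompacts μ] {c : ℝ}
    (hP : ∀ (f : M → ℂ) (df : ∀ x : M, TangentSpace (𝓡 n) x →L[ℝ] ℂ),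
      IsSobolevGradientFun μ f df → ∀ (x : M) (R : ℝ), 0 < R → R ≤ 1 →
        ∫⁻ y in Metric.ball x R,
            ENNReal.ofReal (Complex.normSq (f y - ⨍ z in Metric.ball x R, f z ∂μ)) ∂μ ≤
          ENNReal.ofReal ((c * R) ^ 2) * ∫⁻ y in Metric.ball x R,
            ENNReal.ofReal (Complex.normSq (f y) + gradNormSq Complex.normSq (df y)) ∂μ)
    {x : M} {ρ a : ℝ} (haρ : a < ρ) (hcpt : IsCompact (Metric.closedBall x ρ)) {g : M → ℂ}
    (hg : ContMDiffOn (𝓡 n) 𝓘(ℝ, ℂ) ∞ g (Metric.ball x ρ)) {z : M} {R : ℝ} (hR : 0 < R)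
    (hR1 : R ≤ 1) (hzR : Metric.ball z R ⊆ Metric.ball x a) :
    ∫⁻ y in Metric.ball z R,
        ENNReal.ofReal (Complex.normSq (g y - ⨍ w in Metric.ball z R, g w ∂μ)) ∂μ ≤
      ENNReal.ofReal ((c * R) ^ 2) * ∫⁻ y in Metric.ball z R,
        ENNReal.ofReal (Complex.normSq (g y) +
          gradNormSq Complex.normSq (complexDifferential (n := n) g y)) ∂μ := by
  obtain ⟨f, hf, hfc, hfg⟩ := exists_contMDiff_hasCompactSupport_eqOn haρ hcpt hg
  have hB : MeasurableSet (Metric.ball z R) := Metric.isOpen_ball.measurableSet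
  have havg : ⨍ w in Metric.ball z R, f w ∂μ = ⨍ w in Metric.ball z R, g w ∂μ :=
    setAverage_congr_fun hB (Eventually.of_forall fun w hw => hfg (hzR hw))
  have hd : ∀ y ∈ Metric.ball z R,
      complexDifferential (n := n) f y = complexDifferential (n := n) g y := by
    intro y hy
    have : f =ᶠ[𝓝 y] g := by
      filter_upwards [Metric.isOpen_ball.mem_nhds hy] with w hw using hfg (hzR hw)
    exact this.mfderiv_eq
  have := hP f _ (hf.isSobolevGradientFun hfc) z R hR hR1
  rw [havg] at this
  refine (le_of_eq ?_).trans (this.trans (le_of_eq ?_))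
  · exact setLIntegral_congr_fun hB fun y hy => by simp only [hfg (hzR hy)]
  · congr 1
    exact setLIntegral_congr_fun hB fun y hy => by simp only [hfg (hzR hy), hd y hy]

end Localization

theorem two_mul_ofReal (a : ℝ) : 2 * ENNReal.ofReal a = ENNReal.ofReal (2 * a) := by
  rw [ENNReal.ofReal_mul zero_le_two, ENNReal.ofReal_ofNat]

/-! ### Oscillation of the coordinates of a Sobolev section -/

section Sections

variable {n N : ℕ} {M : Type*} [MetricSpace M] [ChartedSpace (EuclideanSpace ℝ (Fin n)) M]
    [IsManifold (𝓡 n) ∞ M]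
    [RiemannianBundle (fun x : M => TangentSpace (𝓡 n) x)]
    [IsContMDiffRiemannianBundle (𝓡 n) ∞ (EuclideanSpace ℝ (Fin n))
      (fun x : M => TangentSpace (𝓡 n) x)]
    [IsManifold (𝓡 n) 1 M] [MeasurableSpace M] [BorelSpace M]
    {V : M → Type*} [TopologicalSpace (TotalSpace (EuclideanSpace ℂ (Fin N)) V)]
    [∀ x, AddCommGroup (V x)] [∀ x, Module ℂ (V x)] [∀ x, TopologicalSpace (V x)]
    [∀ x, IsTopologicalAddGroup (V x)] [∀ x, ContinuousSMul ℝ (V x)]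
    [FiberBundle (EuclideanSpace ℂ (Fin N)) V]
    [VectorBundle ℂ (EuclideanSpace ℂ (Fin N)) V] [VectorBundle ℝ (EuclideanSpace ℂ (Fin N)) V]
    [ContMDiffVectorBundle ∞ (EuclideanSpace ℂ (Fin N)) V (𝓡 n)]
    {h : HermitianMetric n (EuclideanSpace ℂ (Fin N)) V}
    {conn : CovariantDerivative (𝓡 n) (EuclideanSpace ℂ (Fin N)) V}
    {μ : Measure M}

omit [IsContMDiffRiemannianBundle (𝓡 n) ∞ (EuclideanSpace ℝ (Fin n))
      (fun x : M => TangentSpace (𝓡 n) x)] [IsManifold (𝓡 n) ∞ M]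
    [IsManifold (𝓡 n) 1 M] [MeasurableSpace M] [BorelSpace M]
    [RiemannianBundle (fun x : M => TangentSpace (𝓡 n) x)]
    [∀ x, IsTopologicalAddGroup (V x)] [∀ x, ContinuousSMul ℝ (V x)]
    [VectorBundle ℂ (EuclideanSpace ℂ (Fin N)) V] [VectorBundle ℝ (EuclideanSpace ℂ (Fin N)) V]
    [ContMDiffVectorBundle ∞ (EuclideanSpace ℂ (Fin N)) V (𝓡 n)] in
theorem GBG.normSq_coord_sub_le (G : GBG h) {x y : M} (hy : y ∈ Metric.ball x G.radius)
    (u s : ∀ y, V y) (i : Fin N) :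
    Complex.normSq (G.coord x u i y - G.coord x s i y) ≤ G.const * h.normSq y (s y - u y) := by
  have h1 := G.normSq_coord_le hy (fun y => s y - u y) i
  have h2 : G.coord x (fun y => s y - u y) i y = -(G.coord x u i y - G.coord x s i y) := by
    simp [GBG.coord]
  rwa [h2, Complex.normSq_neg] at h1

/-- The integrals of `|s|² + |∇s|²` for a smooth section `s` near a Sobolev section `u`. -/
theorem IsSobolevGradient.lintegral_approx_le {u s : ∀ x, V x}
    {du : ∀ x, TangentSpace (𝓡 n) x →L[ℝ] V x}
    (hu : IsSobolevGradient μ (EuclideanSpace ℂ (Fin N)) h.normSq conn u du)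
    (hs : ContMDiff (𝓡 n) ((𝓡 n).prod 𝓘(ℝ, EuclideanSpace ℂ (Fin N))) ∞
      (fun y => TotalSpace.mk' (EuclideanSpace ℂ (Fin N)) y (s y))) (B : Set M) :
    ∫⁻ y in B, ENNReal.ofReal (gradNormSq (h.normSq y) (conn s y) + h.normSq y (s y)) ∂μ ≤
      2 * (∫⁻ y in B, ENNReal.ofReal (gradNormSq (h.normSq y) (du y) + h.normSq y (u y)) ∂μ +
        (∫⁻ y, ENNReal.ofReal (h.normSq y (s y - u y)) ∂μ +
          ∫⁻ y, ENNReal.ofReal (gradNormSq (h.normSq y) (conn s y - du y)) ∂μ)) := by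
  have m1 : AEMeasurable (fun y =>
      ENNReal.ofReal (gradNormSq (h.normSq y) (du y) + h.normSq y (u y))) (μ.restrict B) :=
    (((h.aemeasurable_gradNormSq hu.measurable_grad).add
      (h.aemeasurable_normSq hu.measurable)).ennreal_ofReal).restrict
  have m2 : AEMeasurable (fun y => ENNReal.ofReal (h.normSq y (s y - u y))) (μ.restrict B) :=
    (h.aemeasurable_normSq_sub hs hu.measurable).ennreal_ofReal.restrict
  calc ∫⁻ y in B, ENNReal.ofReal (gradNormSq (h.normSq y) (conn s y) + h.normSq y (s y)) ∂μ
      ≤ ∫⁻ y in B, 2 * (ENNReal.ofReal (gradNormSq (h.normSq y) (du y) + h.normSq y (u y)) +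
          (ENNReal.ofReal (h.normSq y (s y - u y)) +
            ENNReal.ofReal (gradNormSq (h.normSq y) (conn s y - du y)))) ∂μ := by
        refine lintegral_mono fun y => ?_
        have h1 := h.gradNormSq_le_two_mul (conn s y) (du y)
        have h2 := h.normSq_add_le y (u y) (s y - u y)
        rw [add_sub_cancel] at h2
        have p1 := h.gradNormSq_nonneg (du y)
        have p2 := h.gradNormSq_nonneg (conn s y - du y)
        have p3 := h.normSq_nonneg y (u y)
        have p4 := h.normSq_nonneg y (s y - u y)
        rw [← ENNReal.ofReal_add p4 p2, ← ENNReal.ofReal_add (by positivity) (by positivity),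
          two_mul_ofReal]
        exact ENNReal.ofReal_le_ofReal (by linarith)
    _ = 2 * (∫⁻ y in B, ENNReal.ofReal (gradNormSq (h.normSq y) (du y) + h.normSq y (u y)) ∂μ +
        (∫⁻ y in B, ENNReal.ofReal (h.normSq y (s y - u y)) ∂μ +
          ∫⁻ y in B, ENNReal.ofReal (gradNormSq (h.normSq y) (conn s y - du y)) ∂μ)) := by
        -- Additivity needs all but one of the summands measurable, so nothing is required of |∇s -
        -- du|².
        rw [lintegral_const_mul' _ _ (by simp), lintegral_add_left' m1, lintegral_add_left' m2]
    _ ≤ _ := by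
        gcongr <;> exact Measure.restrict_le_self

variable [SecondCountableTopology M] (G : GBG h)

/-- The oscillation of the coordinates of a Sobolev section on a small ball. -/
theorem GBG.lintegral_normSq_coord_sub_average_le [IsFiniteMeasureOnCompacts μ] {c : ℝ}
    (hP : ∀ (f : M → ℂ) (df : ∀ x : M, TangentSpace (𝓡 n) x →L[ℝ] ℂ),
      IsSobolevGradientFun μ f df → ∀ (x : M) (R : ℝ), 0 < R → R ≤ 1 →
        ∫⁻ y in Metric.ball x R,
            ENNReal.ofReal (Complex.normSq (f y - ⨍ z in Metric.ball x R, f z ∂μ)) ∂μ ≤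
          ENNReal.ofReal ((c * R) ^ 2) * ∫⁻ y in Metric.ball x R,
            ENNReal.ofReal (Complex.normSq (f y) + gradNormSq Complex.normSq (df y)) ∂μ)
    (conn_complex : ∀ (σ : ∀ x, V x) (x : M),
      MDifferentiableAt (𝓡 n) ((𝓡 n).prod 𝓘(ℝ, EuclideanSpace ℂ (Fin N)))
        (fun y => TotalSpace.mk' (EuclideanSpace ℂ (Fin N)) y (σ y)) x →
      ∀ X : TangentSpace (𝓡 n) x, conn (fun y => Complex.I • σ y) x X = Complex.I • conn σ x X)
    {C_G : ℝ}
    (grad_frame : ∀ (x : M) (i : Fin N), ∀ y ∈ Metric.ball x G.radius,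
      √(gradNormSq (h.normSq y) (conn (G.frame x i) y)) ≤ C_G)
    {u : ∀ x, V x} {du : ∀ x, TangentSpace (𝓡 n) x →L[ℝ] V x}
    (hu : IsSobolevGradient μ (EuclideanSpace ℂ (Fin N)) h.normSq conn u du)
    {x z : M} {a R : ℝ} (ha : a < G.radius)
    (hcpt : IsCompact (Metric.closedBall x G.radius)) (hR : 0 < R) (hR1 : R ≤ 1)
    (hzR : Metric.ball z R ⊆ Metric.ball x a) {Q : Set M} (hQ : Q ⊆ Metric.ball z R)
    (h0 : μ Q ≠ 0) (ht : μ Q ≠ ⊤) {k : ℝ} (hk : 0 ≤ k)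
    (hK : μ (Metric.ball z R) ≤ ENNReal.ofReal k * μ Q) (i : Fin N) :
    ∫⁻ y in Metric.ball z R,
        ENNReal.ofReal (Complex.normSq (G.coord x u i y - ⨍ w in Q, G.coord x u i w ∂μ)) ∂μ ≤
      ENNReal.ofReal (8 * (1 + k) * (c * R) ^ 2 * (G.const + G.gradConst C_G)) *
        ∫⁻ y in Metric.ball z R,
          ENNReal.ofReal (gradNormSq (h.normSq y) (du y) + h.normSq y (u y)) ∂μ := by
  set B := Metric.ball z R
  have hBmeas : MeasurableSet B := Metric.isOpen_ball.measurableSet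
  have hBx : B ⊆ Metric.ball x G.radius := hzR.trans (Metric.ball_subset_ball ha.le)
  set A := G.const + G.gradConst C_G with hA
  have hC0 := G.const_pos
  have hgc : 0 ≤ G.gradConst C_G := by unfold GBG.gradConst; positivity
  set I := ∫⁻ y in B, ENNReal.ofReal (gradNormSq (h.normSq y) (du y) + h.normSq y (u y)) ∂μ
  obtain ⟨s, hs, -, -, hlim1, hlim2⟩ := hu.approx
  set ε : ℕ → ℝ≥0∞ := fun j => ∫⁻ y, ENNReal.ofReal (h.normSq y (s j y - u y)) ∂μ
  set ε' : ℕ → ℝ≥0∞ := fun j =>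
    ∫⁻ y, ENNReal.ofReal (gradNormSq (h.normSq y) (conn (s j) y - du y)) ∂μ
  have hstep : ∀ j, ∫⁻ y in B,
      ENNReal.ofReal (Complex.normSq (G.coord x u i y - ⨍ w in Q, G.coord x u i w ∂μ)) ∂μ ≤
      2 * (1 + ENNReal.ofReal k) * (2 * (ENNReal.ofReal G.const * ε j +
        ENNReal.ofReal ((c * R) ^ 2) * (ENNReal.ofReal A * (2 * (I + (ε j + ε' j)))))) := by
    intro j
    have hsj := (hs j).contMDiffOn (s := Metric.ball x G.radius)
    have hcs := G.contMDiffOn_coord x hsj i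
    -- The comparison constant is the average of the smooth approximant, so that the Poincaré
    -- inequality is applied to that approximant only.
    set m := ⨍ w in B, G.coord x (s j) i w ∂μ
    refine (lintegral_normSq_sub_average_le hQ h0 ht hK ((G.aemeasurable_coord x
      hu.measurable i).mono_measure (Measure.restrict_mono (hQ.trans hBx) le_rfl)) m).trans ?_
    gcongr
    have hmeas : AEMeasurable (fun y =>
        ENNReal.ofReal (Complex.normSq (G.coord x (s j) i y - m))) (μ.restrict B) :=
      ((Complex.continuous_normSq.comp_continuousOn
        ((hcs.continuousOn.mono hBx).sub continuousOn_const)).aemeasurable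
          hBmeas).ennreal_ofReal
    calc ∫⁻ y in B, ENNReal.ofReal (Complex.normSq (G.coord x u i y - m)) ∂μ
        ≤ ∫⁻ y in B, 2 * (ENNReal.ofReal (Complex.normSq
            (G.coord x u i y - G.coord x (s j) i y)) +
            ENNReal.ofReal (Complex.normSq (G.coord x (s j) i y - m))) ∂μ := by
          refine lintegral_mono fun y => ?_
          rw [show G.coord x u i y - m =
            (G.coord x u i y - G.coord x (s j) i y) + (G.coord x (s j) i y - m) by ring]
          exact ofReal_normSq_add_le _ _
      _ = 2 * (∫⁻ y in B, ENNReal.ofReal (Complex.normSq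
            (G.coord x u i y - G.coord x (s j) i y)) ∂μ +
            ∫⁻ y in B, ENNReal.ofReal (Complex.normSq (G.coord x (s j) i y - m)) ∂μ) := by
          rw [lintegral_const_mul' _ _ (by simp), lintegral_add_right' _ hmeas]
      _ ≤ _ := by
          gcongr
          · calc ∫⁻ y in B, ENNReal.ofReal (Complex.normSq
                  (G.coord x u i y - G.coord x (s j) i y)) ∂μ
                ≤ ∫⁻ y in B, ENNReal.ofReal G.const *
                    ENNReal.ofReal (h.normSq y (s j y - u y)) ∂μ := by
                  refine setLIntegral_mono' hBmeas fun y hy => ?_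
                  rw [← ENNReal.ofReal_mul hC0.le]
                  exact ENNReal.ofReal_le_ofReal (G.normSq_coord_sub_le (hBx hy) _ _ i)
              _ = ENNReal.ofReal G.const *
                    ∫⁻ y in B, ENNReal.ofReal (h.normSq y (s j y - u y)) ∂μ :=
                  lintegral_const_mul' _ _ ENNReal.ofReal_ne_top
              _ ≤ _ := mul_le_mul_right (setLIntegral_le_lintegral _ _) _
          · refine (poincare_of_contMDiffOn hP ha hcpt hcs hR hR1 hzR).trans ?_
            gcongr
            refine le_trans ?_ (mul_le_mul_right (hu.lintegral_approx_le (hs j) B) _)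
            rw [← lintegral_const_mul' _ _ ENNReal.ofReal_ne_top]
            refine setLIntegral_mono' hBmeas fun y hy => ?_
            have hAnn : 0 ≤ A := by positivity
            rw [← ENNReal.ofReal_mul hAnn]
            refine ENNReal.ofReal_le_ofReal ?_
            have h1 := G.gradNormSq_coord_le conn_complex grad_frame (hBx hy) hsj i
            have h2 := G.normSq_coord_le (hBx hy) (s j) i
            have h3 := mul_nonneg hC0.le (h.gradNormSq_nonneg (conn (s j) y))
            rw [hA]; linarith
  -- Both errors vanish in the limit. The factor 8 is 2·2·2: change of average, passage from u to
  -- s_j, and passage back in the energy.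
  have hlim : Tendsto (fun j => 2 * (1 + ENNReal.ofReal k) * (2 * (ENNReal.ofReal G.const * ε j +
        ENNReal.ofReal ((c * R) ^ 2) * (ENNReal.ofReal A * (2 * (I + (ε j + ε' j)))))))
      atTop (𝓝 (2 * (1 + ENNReal.ofReal k) * (2 * (ENNReal.ofReal G.const * 0 +
        ENNReal.ofReal ((c * R) ^ 2) * (ENNReal.ofReal A * (2 * (I + (0 + 0)))))))) := by
    refine ENNReal.Tendsto.const_mul ?_ (Or.inr (by finiteness))
    refine ENNReal.Tendsto.const_mul ?_ (Or.inr (by finiteness))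
    refine Tendsto.add (ENNReal.Tendsto.const_mul hlim1 (Or.inr (by finiteness))) ?_
    refine ENNReal.Tendsto.const_mul ?_ (Or.inr (by finiteness))
    refine ENNReal.Tendsto.const_mul ?_ (Or.inr (by finiteness))
    refine ENNReal.Tendsto.const_mul ?_ (Or.inr (by finiteness))
    exact tendsto_const_nhds.add (hlim1.add hlim2)
  refine (ge_of_tendsto' hlim hstep).trans (le_of_eq ?_)
  rw [ENNReal.ofReal_mul (by positivity), ENNReal.ofReal_mul (by positivity),
    ENNReal.ofReal_mul (by norm_num), ENNReal.ofReal_add zero_le_one hk]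
  simp only [mul_zero, zero_add, add_zero, ENNReal.ofReal_one, ENNReal.ofReal_ofNat]
  ring

end Sections

/-! ### The section u_Q and the estimate without gradient -/

section CubeAverage

variable {n N : ℕ} {M : Type*} [MetricSpace M] [ChartedSpace (EuclideanSpace ℝ (Fin n)) M]
  [MeasurableSpace M] [BorelSpace M]
  {V : M → Type*} [TopologicalSpace (TotalSpace (EuclideanSpace ℂ (Fin N)) V)]
  [∀ x, AddCommGroup (V x)] [∀ x, Module ℂ (V x)] [∀ x, TopologicalSpace (V x)]
  [FiberBundle (EuclideanSpace ℂ (Fin N)) V]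
  {h : HermitianMetric n (EuclideanSpace ℂ (Fin N)) V} (G : GBG h) {μ : Measure M}

omit [BorelSpace M] in
theorem GBG.normSq_sub_cubeAverage_le {x y : M} (hy : y ∈ Metric.ball x G.radius) (Q : Set M)
    (u : ∀ y, V y) :
    h.normSq y (u y - G.cubeAverage μ x Q u y) ≤
      G.const * ∑ i, Complex.normSq (G.coord x u i y - ⨍ z in Q, G.coord x u i z ∂μ) := by
  have h1 : u y - G.cubeAverage μ x Q u y =
      ∑ i, (G.coord x u i y - ⨍ z in Q, G.coord x u i z ∂μ) • G.frame x i y := by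
    simp only [sub_smul, Finset.sum_sub_distrib, G.sum_coord_smul_frame, GBG.cubeAverage,
      if_pos hy]
  rw [h1]
  exact G.normSq_sum_smul_frame_le hy _

omit [BorelSpace M] in
-- Off the chart ball u_Q is zero, so the bound holds at every point of M; this serves the large
-- balls, which may leave the chart.
theorem GBG.normSq_cubeAverage_le (x y : M) (Q : Set M) (u : ∀ y, V y) :
    h.normSq y (G.cubeAverage μ x Q u y) ≤
      G.const * ∑ i, Complex.normSq (⨍ z in Q, G.coord x u i z ∂μ) := by
  by_cases hy : y ∈ Metric.ball x G.radius
  · simp only [GBG.cubeAverage, if_pos hy]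
    exact G.normSq_sum_smul_frame_le hy _
  · simp only [GBG.cubeAverage, if_neg hy, h.normSq_zero]
    exact mul_nonneg G.const_pos.le (Finset.sum_nonneg fun _ _ => Complex.normSq_nonneg _)

variable [VectorBundle ℂ (EuclideanSpace ℂ (Fin N)) V]
  [VectorBundle ℝ (EuclideanSpace ℂ (Fin N)) V]
  [ContMDiffVectorBundle ∞ (EuclideanSpace ℂ (Fin N)) V (𝓡 n)]

/-- The deviation from the average over a cube, without any gradient. -/
theorem GBG.lintegral_normSq_sub_cubeAverage_le {u : ∀ x, V x}
    (hu : AEMeasurableSection (EuclideanSpace ℂ (Fin N)) μ u) {x : M} {Q B : Set M}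
    (hQB : Q ⊆ B) (hQ : MeasurableSet Q) (hQx : Q ⊆ Metric.ball x G.radius) (h0 : μ Q ≠ 0)
    (ht : μ Q ≠ ⊤) {k : ℝ} (hk : 0 ≤ k) (hK : μ B ≤ ENNReal.ofReal k * μ Q) :
    ∫⁻ y in B, ENNReal.ofReal (h.normSq y (u y - G.cubeAverage μ x Q u y)) ∂μ ≤
      ENNReal.ofReal (2 * (1 + k * (G.const ^ 2 * N))) *
        ∫⁻ y in B, ENNReal.ofReal (h.normSq y (u y)) ∂μ := by
  have hC0 := G.const_pos
  set T : ℝ := G.const * ∑ i, Complex.normSq (⨍ z in Q, G.coord x u i z ∂μ)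
  have hT : 0 ≤ T := mul_nonneg hC0.le (Finset.sum_nonneg fun _ _ => Complex.normSq_nonneg _)
  set I := ∫⁻ y in B, ENNReal.ofReal (h.normSq y (u y)) ∂μ
  -- Cauchy–Schwarz with comparison constant 0. The chart is needed only on `Q`, not on `B`.
  have hcoord : ∀ i, μ Q * ENNReal.ofReal (Complex.normSq (⨍ z in Q, G.coord x u i z ∂μ)) ≤
      ENNReal.ofReal G.const * I := by
    intro i
    have h1 := ofReal_normSq_average_sub_le h0 ht ((G.aemeasurable_coord x
      hu i).mono_measure (Measure.restrict_mono hQx le_rfl)) 0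
    simp only [sub_zero] at h1
    refine h1.trans (le_trans ?_ (mul_le_mul_right (lintegral_mono_set hQB) _))
    rw [← lintegral_const_mul' _ _ ENNReal.ofReal_ne_top]
    refine setLIntegral_mono' hQ fun y hy => ?_
    rw [← ENNReal.ofReal_mul hC0.le]
    exact ENNReal.ofReal_le_ofReal (G.normSq_coord_le (hQx hy) u i)
  have hTQ : ENNReal.ofReal T * μ Q ≤ ENNReal.ofReal (G.const ^ 2 * N) * I := by
    calc ENNReal.ofReal T * μ Q = ENNReal.ofReal G.const *
          ∑ i, μ Q * ENNReal.ofReal (Complex.normSq (⨍ z in Q, G.coord x u i z ∂μ)) := by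
          rw [ENNReal.ofReal_mul hC0.le, ENNReal.ofReal_sum_of_nonneg
            fun _ _ => Complex.normSq_nonneg _, ← Finset.mul_sum]
          ring
      _ ≤ ENNReal.ofReal G.const * ∑ _i : Fin N, ENNReal.ofReal G.const * I := by
          exact mul_le_mul_right (Finset.sum_le_sum fun i _ => hcoord i) _
      _ = ENNReal.ofReal (G.const ^ 2 * N) * I := by
          rw [ENNReal.ofReal_mul (by positivity), ENNReal.ofReal_pow hC0.le,
            ENNReal.ofReal_natCast]
          simp
          ring
  calc ∫⁻ y in B, ENNReal.ofReal (h.normSq y (u y - G.cubeAverage μ x Q u y)) ∂μ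
      ≤ ∫⁻ y in B, 2 * (ENNReal.ofReal (h.normSq y (u y)) + ENNReal.ofReal T) ∂μ := by
        refine lintegral_mono fun y => ?_
        have h1 := h.normSq_add_le y (u y) ((-1 : ℂ) • G.cubeAverage μ x Q u y)
        rw [h.normSq_smul, neg_one_smul, ← sub_eq_add_neg] at h1
        simp only [map_one, Complex.normSq_neg, one_mul] at h1
        rw [← ENNReal.ofReal_add (h.normSq_nonneg _ _) hT, two_mul_ofReal]
        exact ENNReal.ofReal_le_ofReal (by linarith [G.normSq_cubeAverage_le (μ := μ) x y Q u])
    _ = 2 * (I + ENNReal.ofReal T * μ B) := by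
        rw [lintegral_const_mul' _ _ (by simp), lintegral_add_right _ measurable_const]
        simp [I]
    _ ≤ 2 * (I + ENNReal.ofReal k * (ENNReal.ofReal (G.const ^ 2 * N) * I)) := by
        refine mul_le_mul_right (add_le_add_right ?_ _) _
        calc ENNReal.ofReal T * μ B ≤ ENNReal.ofReal T * (ENNReal.ofReal k * μ Q) := by gcongr
          _ = ENNReal.ofReal k * (ENNReal.ofReal T * μ Q) := by ring
          _ ≤ _ := by gcongr
    _ = _ := by
        rw [ENNReal.ofReal_mul zero_le_two, ENNReal.ofReal_add zero_le_one (by positivity),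
          ENNReal.ofReal_mul hk]
        simp only [ENNReal.ofReal_one, ENNReal.ofReal_ofNat]
        ring

end CubeAverage

/-! ### Small and large balls -/

theorem proposition5p2 {n N : ℕ}
    -- a smooth complete Riemannian manifold `M`
    {M : Type*} [MetricSpace M] [ChartedSpace (EuclideanSpace ℝ (Fin n)) M]
    [IsManifold (𝓡 n) ∞ M] [SecondCountableTopology M]
    [RiemannianBundle (fun x : M => TangentSpace (𝓡 n) x)]
    [IsContMDiffRiemannianBundle (𝓡 n) ∞ (EuclideanSpace ℝ (Fin n))
      (fun x : M => TangentSpace (𝓡 n) x)]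
    [IsRiemannianManifold (𝓡 n) M] [CompleteSpace M] [MeasurableSpace M] [BorelSpace M]
    -- a smooth complex vector bundle `V` of rank `N` over `M`
    {V : M → Type*} [TopologicalSpace (TotalSpace (EuclideanSpace ℂ (Fin N)) V)]
    [∀ x, AddCommGroup (V x)] [∀ x, Module ℂ (V x)] [∀ x, TopologicalSpace (V x)]
    [∀ x, IsTopologicalAddGroup (V x)] [∀ x, ContinuousSMul ℝ (V x)]
    [FiberBundle (EuclideanSpace ℂ (Fin N)) V]
    [VectorBundle ℂ (EuclideanSpace ℂ (Fin N)) V] [VectorBundle ℝ (EuclideanSpace ℂ (Fin N)) V]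
    [ContMDiffVectorBundle ∞ (EuclideanSpace ℂ (Fin N)) V (𝓡 n)]
    -- its metric and its connection
    (h : HermitianMetric n (EuclideanSpace ℂ (Fin N)) V)
    (conn : CovariantDerivative (𝓡 n) (EuclideanSpace ℂ (Fin N)) V)
    [CovariantDerivative.ContMDiffCovariantDerivative conn ∞]
    (conn_complex : ∀ (σ : ∀ x, V x) (x : M),
      MDifferentiableAt (𝓡 n) ((𝓡 n).prod 𝓘(ℝ, EuclideanSpace ℂ (Fin N)))
        (fun y => TotalSpace.mk' (EuclideanSpace ℂ (Fin N)) y (σ y)) x →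
      ∀ X : TangentSpace (𝓡 n) x, conn (fun y => Complex.I • σ y) x X = Complex.I • conn σ x X)
    -- exponential local doubling and the local Poincaré inequality
    {c κ lam : ℝ} (doubling : ExpLocallyDoubling (riemannianVolume n M) c κ lam)
    (poincare : LocalPoincare n (riemannianVolume n M))
    -- generalised bounded geometry, with `|∇e^i| ≤ C_G` in each GBG chart
    (G : GBG h) {C_G : ℝ} (hC_G : 0 < C_G)
    (grad_frame : ∀ (x : M) (i : Fin N), ∀ y ∈ Metric.ball x G.radius,
      √(gradNormSq (h.normSq y) (conn (G.frame x i) y)) ≤ C_G)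
    -- the dyadic cubes, and the generation `J` that fixes the scale `δ ^ J`
    (D : DyadicStructure (riemannianVolume n M)) {J : ℕ} (hJ : D.C₁ * D.δ ^ J ≤ G.radius / 5) :
    ∃ C : ℝ, 0 < C ∧
      ∀ (u : ∀ x, V x) (du : ∀ x, TangentSpace (𝓡 n) x →L[ℝ] V x),
        IsSobolevGradient (riemannianVolume n M) (EuclideanSpace ℂ (Fin N)) h.normSq conn u du →
      ∀ t : ℝ, 0 < t → t ≤ D.δ ^ J →
      -- `Q = D.cube k α` is in `𝒟_t`, and `D.cube J β` is its GBG cube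
      ∀ (k : ℕ), D.δ ^ (k + 1) < t → t ≤ D.δ ^ k →
      ∀ (α : D.ι k) (β : D.ι J), D.cube k α ⊆ D.cube J β →
      ∀ r : ℝ, D.C₁ / D.δ ≤ r →
        ∫⁻ y in Metric.ball (D.centre k α) (r * t),
            ENNReal.ofReal (h.normSq y (u y -
              G.cubeAverage (riemannianVolume n M) (D.centre J β) (D.cube k α) u y))
            ∂(riemannianVolume n M) ≤
          ENNReal.ofReal (C * (1 + r ^ κ * Real.exp (lam * (r * t))) * (r * t) ^ 2) *
            ∫⁻ y in Metric.ball (D.centre k α) (r * t),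
              ENNReal.ofReal (gradNormSq (h.normSq y) (du y) + h.normSq y (u y))
              ∂(riemannianVolume n M) := by
  revert D
  -- From here on the volume enters only through the doubling, Poincaré and cube hypotheses.
  generalize riemannianVolume n M = μ at doubling poincare
  intro D hJ
  obtain ⟨cP, -, hP⟩ := poincare
  have hfin : IsFiniteMeasureOnCompacts μ := ⟨fun K hK => by
    rcases K.eq_empty_or_nonempty with rfl | ⟨x₀, -⟩
    · simp
    obtain ⟨R, hR⟩ := hK.isBounded.subset_ball x₀
    exact (measure_mono (hR.trans (Metric.ball_subset_ball (le_max_left R 1)))).trans_lt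
      (doubling.lt_top x₀ _ (by positivity))⟩
  have hρ := G.radius_pos
  have hC0 := G.const_pos
  set A := G.const + G.gradConst C_G
  have hA : 0 ≤ A := by
    have : 0 ≤ G.gradConst C_G := by unfold GBG.gradConst; positivity
    positivity
  -- K₁ is the constant of `measure_ball_le` with a = a₀; Cs serves the small balls and Cl the large
  -- ones. Cs vanishes for N = 0, so positivity of the sum rests on Cl.
  set K₁ : ℝ := max 1 (c * (D.a₀ ^ κ)⁻¹)
  have hK₁ : 1 ≤ K₁ := le_max_left _ _
  set Cs : ℝ := G.const * (N * (8 * (1 + K₁) * cP ^ 2 * A))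
  set Cl : ℝ := 2 * (1 + K₁ * (G.const ^ 2 * N)) * (25 / G.radius ^ 2)
  have hCs : 0 ≤ Cs := by positivity
  have hCl : 0 < Cl := by positivity
  refine ⟨Cs + Cl, by positivity, ?_⟩
  intro u du hu t ht htJ k hkt htk α β hαβ r hr
  have hδ := D.δ_pos
  have hr0 : 0 < r := (div_pos D.C₁_pos hδ).trans_le hr
  set R := r * t with hRdef
  have hR : 0 < R := mul_pos hr0 ht
  set z := D.centre k α
  set x := D.centre J β
  set Q := D.cube k α
  set B := Metric.ball z R
  set E := r ^ κ * Real.exp (lam * R)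
  have hE : 0 ≤ E := by positivity
  have hQB : Q ⊆ B := by
    intro y hy
    have h1 : edist y z ≤ ENNReal.ofReal (D.C₁ * D.δ ^ k) :=
      (Metric.edist_le_ediam_of_mem hy (D.centre_mem k α)).trans (D.diam_le k α)
    have hCk : 0 ≤ D.C₁ * D.δ ^ k := mul_nonneg D.C₁_pos.le (pow_nonneg hδ.le _)
    rw [edist_dist, ENNReal.ofReal_le_ofReal_iff hCk] at h1
    refine Metric.mem_ball.2 (h1.trans_lt ?_)
    -- This is where r ≥ C₁/δ enters: t exceeds δ^(k+1), not δ^k.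
    calc D.C₁ * D.δ ^ k = D.C₁ / D.δ * D.δ ^ (k + 1) := by field_simp; ring
      _ < D.C₁ / D.δ * t := mul_lt_mul_of_pos_left hkt (div_pos D.C₁_pos hδ)
      _ ≤ r * t := mul_le_mul_of_nonneg_right hr ht.le
  have hdiam : ∀ y ∈ D.cube J β, dist y x ≤ G.radius / 5 := by
    intro y hy
    have h1 : edist y x ≤ ENNReal.ofReal (G.radius / 5) :=
      ((Metric.edist_le_ediam_of_mem hy (D.centre_mem J β)).trans (D.diam_le J β)).trans
        (ENNReal.ofReal_le_ofReal hJ)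
    rwa [edist_dist, ENNReal.ofReal_le_ofReal_iff (by positivity)] at h1
  have hQx : Q ⊆ Metric.ball x G.radius := fun y hy =>
    Metric.mem_ball.2 ((hdiam y (hαβ hy)).trans_lt (by linarith))
  have h0 : μ Q ≠ 0 := ((doubling.pos z _ (mul_pos D.a₀_pos (pow_pos hδ k))).trans_le
    (measure_mono (D.ball_subset k α))).ne'
  have hQt : μ Q ≠ ⊤ := ((measure_mono hQB).trans_lt (doubling.lt_top z R hR)).ne
  have hK : μ B ≤ ENNReal.ofReal (K₁ * (1 + E)) * μ Q :=
    (doubling.measure_ball_le z D.a₀_pos ht htk hr0).trans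
      (mul_le_mul_right (measure_mono (D.ball_subset k α)) _)
  have hk0 : 0 ≤ K₁ * (1 + E) := by positivity
  have hBmeas : MeasurableSet B := Metric.isOpen_ball.measurableSet
  set I := ∫⁻ y in B, ENNReal.ofReal (gradNormSq (h.normSq y) (du y) + h.normSq y (u y)) ∂μ
  -- For R ≤ ρ/5 the ball `B` lies in B(x, 2ρ/5), which leaves room for the cut-off, and ρ ≤ 5 gives
  -- R ≤ 1, as the Poincaré inequality requires.
  rcases le_or_gt R (G.radius / 5) with hRρ | hRρ
  · have hzx : dist z x ≤ G.radius / 5 := hdiam z (hαβ (D.centre_mem k α))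
    have hBx : B ⊆ Metric.ball x (2 * G.radius / 5) :=
      Metric.ball_subset_ball' (by linarith)
    have hBρ : B ⊆ Metric.ball x G.radius := hBx.trans (Metric.ball_subset_ball (by linarith))
    have hosc := G.lintegral_normSq_coord_sub_average_le hP conn_complex grad_frame hu
      (by linarith) (doubling.isCompact_closedBall x G.radius) hR
      (by linarith [G.radius_le]) hBx hQB h0 hQt hk0 hK
    have hmeas : ∀ i, AEMeasurable (fun y => ENNReal.ofReal
        (Complex.normSq (G.coord x u i y - ⨍ w in Q, G.coord x u i w ∂μ))) (μ.restrict B) :=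
      fun i => (Complex.continuous_normSq.measurable.comp_aemeasurable
        (((G.aemeasurable_coord x hu.measurable i).mono_measure
          (Measure.restrict_mono hBρ le_rfl)).sub_const _)).ennreal_ofReal
    calc ∫⁻ y in B, ENNReal.ofReal (h.normSq y (u y - G.cubeAverage μ x Q u y)) ∂μ
        ≤ ∫⁻ y in B, ENNReal.ofReal G.const * ∑ i, ENNReal.ofReal
            (Complex.normSq (G.coord x u i y - ⨍ w in Q, G.coord x u i w ∂μ)) ∂μ := by
          refine setLIntegral_mono' hBmeas fun y hy => ?_
          rw [← ENNReal.ofReal_sum_of_nonneg fun _ _ => Complex.normSq_nonneg _,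
            ← ENNReal.ofReal_mul hC0.le]
          exact ENNReal.ofReal_le_ofReal (G.normSq_sub_cubeAverage_le (hBρ hy) Q u)
      _ = ENNReal.ofReal G.const * ∑ i, ∫⁻ y in B, ENNReal.ofReal
            (Complex.normSq (G.coord x u i y - ⨍ w in Q, G.coord x u i w ∂μ)) ∂μ := by
          rw [lintegral_const_mul' _ _ ENNReal.ofReal_ne_top,
            lintegral_finsetSum' _ fun i _ => hmeas i]
      _ ≤ ENNReal.ofReal G.const * ∑ _i : Fin N,
            ENNReal.ofReal (8 * (1 + K₁ * (1 + E)) * (cP * R) ^ 2 * A) * I := by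
          gcongr with i
          exact hosc i
      _ = ENNReal.ofReal
            (G.const * (N * (8 * (1 + K₁ * (1 + E)) * (cP * R) ^ 2 * A))) * I := by
          rw [ENNReal.ofReal_mul hC0.le, ENNReal.ofReal_mul (Nat.cast_nonneg _),
            ENNReal.ofReal_natCast]
          simp [mul_assoc]
      _ ≤ ENNReal.ofReal ((Cs + Cl) * (1 + E) * R ^ 2) * I := by
          refine mul_le_mul_left (ENNReal.ofReal_le_ofReal ?_) _
          calc G.const * (N * (8 * (1 + K₁ * (1 + E)) * (cP * R) ^ 2 * A))
              ≤ G.const * (N * (8 * ((1 + K₁) * (1 + E)) * (cP * R) ^ 2 * A)) := by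
                gcongr; linarith
            _ = Cs * (1 + E) * R ^ 2 := by simp only [Cs]; ring
            _ ≤ (Cs + Cl) * (1 + E) * R ^ 2 := by gcongr; linarith
  · refine (G.lintegral_normSq_sub_cubeAverage_le hu.measurable hQB
      (D.isOpen k α).measurableSet hQx h0 hQt hk0 hK).trans ?_
    refine mul_le_mul' (ENNReal.ofReal_le_ofReal ?_) (lintegral_mono fun y =>
      ENNReal.ofReal_le_ofReal (le_add_of_nonneg_left (h.gradNormSq_nonneg _)))
    -- Since R > ρ/5, the factor R² costs only the constant 25/ρ².
    have hone : 1 ≤ 25 / G.radius ^ 2 * R ^ 2 := by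
      rw [div_mul_eq_mul_div, one_le_div (by positivity)]
      nlinarith
    calc 2 * (1 + K₁ * (1 + E) * (G.const ^ 2 * N))
        ≤ 2 * ((1 + K₁ * (G.const ^ 2 * N)) * (1 + E)) := by linarith
      _ = 2 * (1 + K₁ * (G.const ^ 2 * N)) * (1 + E) * 1 := by ring
      _ ≤ 2 * (1 + K₁ * (G.const ^ 2 * N)) * (1 + E) * (25 / G.radius ^ 2 * R ^ 2) := by
          gcongr
      _ = Cl * (1 + E) * R ^ 2 := by simp only [Cl]; ring
      _ ≤ (Cs + Cl) * (1 + E) * R ^ 2 := by gcongr; linarith
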